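/- **System.** Let $G=(V,E)$ be a finite connected simple undirected graph with $n$ nodes (processors) and a distinguished node $v_1$ (the root). Every node $v_i$ numbers its $\delta_i$ incident edges by $1,\dots,\delta_i$ in an arbitrary order; $\alpha_i(j)$ is the number that $v_i$ gives to the edge $(v_i,v_j)$, and $v_i$ knows $\alpha_j(i)$ for each neighbour $v_j$. Let $N\ge n$. Each $v_i$ owns a register with fields $path_i$, $count_i$ (an integer) and $bcc_i$, which $v_i$ can read and write and which its neighbours can read. Values of $path$ and $bcc$ are finite sequences of symbols from $\{\bot,1,2,\dots\}$, ordered lexicographically by $\prec$ (with $\bot$ the least symbol and a proper prefix smaller than the sequence); $\oplus$ is concatenation and $|w|_N$ is the sequence of the last (rightmost) $N$ symbols of $w$ (or $w$ itself, if it is shorter). **The algorithm (2-EDGE & 2-VERTEX CONNECTIVITY).** The root repeats forever: write $path_1:=\bot$; write $count_1:=0$; write $bcc_1:=\bot$. Every other node $v_i$, whose neighbour along its edge number $j$ is denoted $v_{i_j}$, repeats forever: 1. for $j=1,\dots,\delta_i$: $read\_path_j:=$ read$(path_{i_j})$; 2. write $path_i:=\min_\prec\{\,|read\_path_j\oplus\alpha_{i_j}(i)|_N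 : 1\le j\le\delta_i\}$; 3. $path:=$ read$(path_i)$; $count:=0$; 4. for $j=1,\dots,\delta_i$: if $read\_path_j=path\oplus\alpha_i(i_j)$ (child link), then $read\_count_j:=$ read$(count_{i_j})$ and $count:=count+read\_count_j$; else if $read\_path_j=path\oplus s$ for some $s\ne\alpha_i(i_j)$ (incoming non-tree edge), then $count:=count-1$; else if $path=read\_path_j\oplus s$ for some $s\neq\alpha_{i_j}(i)$ (outgoing non-tree edge), then $count:=count+1$; 5. write $count_i:=count$; 6. $count:=$ read$(count_i)$; $path:=$ read$(path_i)$; 7. if $count=0$, write $bcc_i:=path$; otherwise, for $j=1,\dots,\delta_i$: if $path=read\_path_j\oplus\alpha_{i_j}(i)$ (parent link), then $read\_bcc_j:=$ read$(bcc_{i_j})$ and write $bcc_i:=read\_bcc_j$. **Executions.** A configuration consists of the contents of all registers and the program counters and local variables of all processors. An atomic step of a processor is an internal computation followed by exactly one read or exactly one write. An execution is an infinite sequence of configurations $c_0,c_1,\dots$, with $c_0$ arbitrary, in which $c_{t+1}$ arises from $c_t$ by one atomic step of a single processor, chosen by the scheduler; it is fair if every processor executes infinitely many atomic steps. **Representative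 nodes.** A path from $v_1$ to $v_i$ (without repeated nodes) is represented by $\bot$ followed by the numbers of its successive edges, each given by the endpoint at which the edge is left. The first depth-first search tree $T$ is given by the $\prec$-smallest paths: $v_j$ is an ancestor of $v_i$ (possibly $v_i$ itself) if the smallest path of $v_j$ is a prefix of the smallest path of $v_i$. The bridge-connected components of $G$ are the connected components of the graph obtained from $G$ by deleting all its bridges. A representative node of a component is a node of the component that is an ancestor of all nodes of the component. **Theorem.** Every bridge-connected component has exactly one representative node. Every fair execution of the algorithm has a suffix such that in every configuration of it, for every node $v_i$, $path_i$ is the smallest path from $v_1$ to $v_i$, and $bcc_i=path_t$, where $v_t$ is the representative node of the bridge-connected component containing $v_i$. -/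

import Mathlib

/-- The value of a `path` or `bcc` field: a finite sequence of symbols, each of which is either `⊥`
or an edge index. Sequences are compared lexicographically, `⊥` is the smallest symbol and a proper
prefix of a sequence is smaller than the sequence (Mathlib's order on `List (WithBot ℕ)`). -/
abbrev PathValue : Type := List (WithBot ℕ)

/-- The underlying data of the distributed system: the communication graph, the distinguished
processor, for each processor `v` an arbitrary ordering of its incident edges (given as a bijection
between its neighbours and its ports), and the bound `N` on the length of `path` values. -/
structure Network (V : Type*) [Fintype V] where
  graph : SimpleGraph V
  [decAdj : DecidableRel graph.Adj]
  root : V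
  port : (v : V) → graph.neighborSet v ≃ Fin (graph.degree v)
  bound : ℕ

namespace Network

attribute [instance] Network.decAdj

variable {V : Type*} [Fintype V] (net : Network V)

/-- The edge index, in `{1, …, deg v}`, that `v` gives to its edge to `w`. -/
def edgeIndex {v w : V} (h : net.graph.Adj v w) : WithBot ℕ :=
  (((net.port v ⟨w, h⟩ : ℕ) + 1 : ℕ) : WithBot ℕ)

/-- The number of edges at `v`. -/
abbrev deg (v : V) : ℕ := net.graph.degree v

/-- The neighbour of `v` behind its port `j`. -/
def nbr (v : V) (j : Fin (net.deg v)) : V := ((net.port v).symm j : V)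

theorem adj_nbr (v : V) (j : Fin (net.deg v)) : net.graph.Adj v (net.nbr v j) :=
  ((net.port v).symm j).2

/-- The index that `v` itself gives to the edge at its port `j`. -/
def ownIndex (v : V) (j : Fin (net.deg v)) : WithBot ℕ := net.edgeIndex (net.adj_nbr v j)

/-- The index that the neighbour of `v` at port `j` gives to the edge joining it to `v`. -/
def farIndex (v : V) (j : Fin (net.deg v)) : WithBot ℕ := net.edgeIndex (net.adj_nbr v j).symm

/-! ### The depth-first search tree and the bridge-connected components -/

/-- The sequence of edge indices along a walk, each edge being indexed by the processor at which it
is left. -/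
def indices : {u v : V} → net.graph.Walk u v → PathValue
  | _, _, .nil => []
  | _, _, .cons h p => net.edgeIndex h :: indices p

/-- The representations `⊥ e₁ e₂ … eₖ` of the (simple) paths from the root to `v`. -/
def rootPaths (v : V) : Set PathValue :=
  {w | ∃ p : net.graph.Walk net.root v, p.IsPath ∧ w = ⊥ :: net.indices p}

/-- `w` represents the smallest path from the root to `v`. -/
def IsSmallestPath (v : V) (w : PathValue) : Prop := IsLeast (net.rootPaths v) w

/-- `u` is an ancestor of `v` (possibly `v` itself) in the first depth-first search tree: the
smallest path of `u` is a prefix of the smallest path of `v`. -/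
def IsAncestor (u v : V) : Prop :=
  ∃ wu wv : PathValue, net.IsSmallestPath u wu ∧ net.IsSmallestPath v wv ∧ wu <+: wv

/-- `u` and `v` lie in the same bridge-connected component, i.e. they are joined by a walk that
uses no bridge of the graph. -/
def SameComponent (u v : V) : Prop :=
  (net.graph.deleteEdges {e | net.graph.IsBridge e}).Reachable u v

/-- `u` is a representative node of the bridge-connected component that contains `v`. -/
def IsRepresentative (u v : V) : Prop :=
  net.SameComponent u v ∧ ∀ w, net.SameComponent w v → net.IsAncestor u w

end Network

/-! ### The algorithm -/

/-- The shared register of a processor. -/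
structure Register where
  path : PathValue
  count : ℤ
  bcc : PathValue

/-- Program counter of the root, named after the next instruction. -/
inductive RootPC
  | writePath
  | writeCount
  | writeBcc

/-- Program counter of a non-root processor with `d` ports: the position of the program between two
atomic steps. -/
inductive NodePC (d : ℕ)
  /-- at the head of the loop that reads the `path` fields; `j` iterations are done, and when `j = d`
  the loop is over and the new `path` value has to be written -/
  | pathLoop (j : Fin (d + 1))
  /-- before `path := read (pathᵢ)` at the beginning of the `count` phase -/
  | loadPath
  /-- before `in := out := count := 0` -/
  | initCount
  /-- in the `count` loop, just after the `count` field of the neighbour at port `j` was read -/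
  | gotCount (j : Fin d)
  /-- before `count := read (countᵢ)` -/
  | loadCount
  /-- before `path := read (pathᵢ)` at the beginning of the `bcc` phase -/
  | reloadPath
  /-- before the test `count = 0` -/
  | testCount
  /-- in the `bcc` loop, just after the `bcc` field of the neighbour at port `j` was read -/
  | gotBcc (j : Fin d)
  /-- in the `bcc` loop, at the end of the iteration for port `j`, after its write -/
  | wroteBcc (j : Fin d)

/-- Program counter and local variables of a non-root processor with `d` ports. -/
structure NodeState (d : ℕ) where
  pc : NodePC d
  path : PathValue
  count : ℤ
  readPath : Fin d → PathValue
  readCount : Fin d → ℤ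
  readBcc : Fin d → PathValue

/-- The ports with (zero-based) number at least `k`, in increasing order. -/
def portsFrom (d k : ℕ) : List (Fin d) := (List.finRange d).drop k

namespace Network

variable {V : Type*} [Fintype V] (net : Network V)

/-- The smallest of the sequences `|read_pathⱼ ⊕ α|_N`, where `α` is the index given by the `j`-th
neighbour to the edge and `|·|_N` keeps the last (rightmost) `N` symbols of a sequence.
(The default value is irrelevant: a non-root processor of a connected graph has a neighbour.) -/
def newPath (v : V) (s : NodeState (net.deg v)) : PathValue :=
  ((List.finRange (net.deg v)).map fun j =>
    (s.readPath j ++ [net.farIndex v j]).rtake net.bound).min?.getD [⊥]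

/-- The internal computation in the `count` loop: it goes through the listed ports, with current
value `c` of the variable `count`, up to the first child link. It returns the new value of `count`
and the port of that child link, if there is one. -/
def scanCount (v : V) (s : NodeState (net.deg v)) :
    List (Fin (net.deg v)) → ℤ → ℤ × Option (Fin (net.deg v))
  | [], c => (c, none)
  | j :: js, c =>
    -- child link
    if s.readPath j = s.path ++ [net.ownIndex v j] then (c, some j)
    -- incoming non-tree edge
    else if s.path <+: s.readPath j ∧ s.readPath j ≠ s.path ++ [net.ownIndex v j] then
      scanCount v s js (c - 1)
    -- outgoing non-tree edge
    else if s.readPath j <+: s.path ∧ s.path ≠ s.readPath j ++ [net.farIndex v j] then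
      scanCount v s js (c + 1)
    else scanCount v s js c

/-- Atomic step in the loop that reads the `path` fields: read the `path` field of the next
neighbour or, if there is none left, write `pathᵢ`. The result is the new local state and the new
content of the register of `v`. -/
def pathStep (v : V) (reg : V → Register) (s : NodeState (net.deg v))
    (j : Fin (net.deg v + 1)) : NodeState (net.deg v) × Register :=
  if h : (j : ℕ) < net.deg v then
    ({ s with
        readPath := Function.update s.readPath ⟨j, h⟩ (reg (net.nbr v ⟨j, h⟩)).path
        pc := .pathLoop ⟨j + 1, Nat.succ_lt_succ h⟩ }, reg v)
  else
    ({ s with pc := .loadPath }, { reg v with path := net.newPath v s })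

/-- Atomic step in the `count` loop, when the listed ports remain and `c` is the current value of
the variable `count`: read the `count` field of the next child or, if there is none left, write
`countᵢ`. -/
def countStep (v : V) (reg : V → Register) (s : NodeState (net.deg v))
    (js : List (Fin (net.deg v))) (c : ℤ) : NodeState (net.deg v) × Register :=
  match net.scanCount v s js c with
  | (c', some j) =>
    ({ s with
        count := c'
        readCount := Function.update s.readCount j (reg (net.nbr v j)).count
        pc := .gotCount j }, reg v)
  | (c', none) =>
    ({ s with count := c', pc := .loadCount }, { reg v with count := c' })

/-- Atomic step in the `bcc` loop, when the listed ports remain: read the `bcc` field behind the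
next parent link or, if there is none left, start the main loop again, which begins with a read. -/
def bccStep (v : V) (reg : V → Register) (s : NodeState (net.deg v))
    (js : List (Fin (net.deg v))) : NodeState (net.deg v) × Register :=
  match js.find? fun j => s.path = s.readPath j ++ [net.farIndex v j] with
  | some j =>
    ({ s with
        readBcc := Function.update s.readBcc j (reg (net.nbr v j)).bcc
        pc := .gotBcc j }, reg v)
  | none => net.pathStep v reg s 0

/-- One atomic step of the non-root processor `v`: an internal computation followed by exactly one
read of a field or exactly one write to a field of the register of `v`. -/
def nodeStep (v : V) (reg : V → Register) (s : NodeState (net.deg v)) :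
    NodeState (net.deg v) × Register :=
  match s.pc with
  | .pathLoop j => net.pathStep v reg s j
  | .loadPath => ({ s with path := (reg v).path, pc := .initCount }, reg v)
  | .initCount => net.countStep v reg s (portsFrom (net.deg v) 0) 0
  | .gotCount j =>
    net.countStep v reg s (portsFrom (net.deg v) (j + 1)) (s.count + s.readCount j)
  | .loadCount => ({ s with count := (reg v).count, pc := .reloadPath }, reg v)
  | .reloadPath => ({ s with path := (reg v).path, pc := .testCount }, reg v)
  | .testCount =>
    if s.count = 0 then
      ({ s with pc := .pathLoop 0 }, { reg v with bcc := s.path })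
    else net.bccStep v reg s (portsFrom (net.deg v) 0)
  | .gotBcc j => ({ s with pc := .wroteBcc j }, { reg v with bcc := s.readBcc j })
  | .wroteBcc j => net.bccStep v reg s (portsFrom (net.deg v) (j + 1))

/-- One atomic step of the root. -/
def rootStep (r : Register) : RootPC → RootPC × Register
  | .writePath => (.writeCount, { r with path := [⊥] })
  | .writeCount => (.writeBcc, { r with count := 0 })
  | .writeBcc => (.writePath, { r with bcc := [⊥] })

/-- A configuration: the registers of all processors, the program counter of the root, and the
program counters and local variables of the other processors. -/
structure Config where
  reg : V → Register
  rootPC : RootPC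
  node : (v : {v : V // v ≠ net.root}) → NodeState (net.deg v)

variable [DecidableEq V]

/-- The configuration reached from `c` when the scheduler activates processor `v`. -/
def step (v : V) (c : net.Config) : net.Config :=
  if h : v = net.root then
    let r := rootStep (c.reg v) c.rootPC
    { c with reg := Function.update c.reg v r.2, rootPC := r.1 }
  else
    let r := net.nodeStep v c.reg (c.node ⟨v, h⟩)
    { c with
      reg := Function.update c.reg v r.2
      node := Function.update c.node ⟨v, h⟩ r.1 }

/-- `c 0, c 1, …` is an execution, from an arbitrary configuration `c 0`, in which the scheduler
activates processor `sched t` in the configuration `c t`. -/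
def IsExecution (sched : ℕ → V) (c : ℕ → net.Config) : Prop :=
  ∀ t, c (t + 1) = net.step (sched t) (c t)

/-- A fair execution: an execution in which every processor executes infinitely many steps. -/
def IsFairExecution (sched : ℕ → V) (c : ℕ → net.Config) : Prop :=
  net.IsExecution sched c ∧ ∀ v : V, {t : ℕ | sched t = v}.Infinite

end Network

/-!
Choose `P v`, the smallest path of `v` from the root. All statements about executions reduce to the
combinatorics of `P` and to one convergence principle.

*The tree.* A walk is determined by its index sequence, and a smallest path without its last edge is
again smallest (`smallestPath_of_concat`). Hence the prefix order on the values `P v` is that of a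
tree, and every edge of the graph joins a node to one of its ancestors (`prefix_or_prefix_of_adj`):
otherwise the larger end would have a smaller path through the other end. The edges outside the tree
are therefore back edges. The integer `backCount P v` counts the back edges that leave the subtree
of `v`; it satisfies the recursion of the algorithm (`backCount_eq_sum_ports`), and it vanishes if
and only if the edge from `v` to its parent is a bridge (`isBridge_iff_backCount_eq_zero`). A
component cannot leave the subtree below a bridge, so that the representative of the component of
`v` is `v` itself if `v` is the root or `backCount P v = 0`, and that of the parent of `v`
otherwise. Uniqueness holds since two nodes that are ancestors of each other are equal.

*The executions.* A processor traverses its program cyclically, so it completes infinitely many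
cycles (`exists_writePath`); consequently, facts that hold for the registers of the neighbours from
some time on are inherited by the local variables and the register of the processor
(`eventually_of_cycle`).

For `path`, the nodes settle in the order of their smallest paths. Once all nodes with smaller paths
than `v` have settled, a value at another node that stems from a settled node starts with the path
of that node and an edge index leading to a node that has not settled, and so it is at least `P v`
(`smallestPath_le_append`). The values that do not stem from a settled node
end in more and more edge indices, until truncation to the last `N` symbols has removed every `⊥`;
such a sequence exceeds `P v`, which starts with `⊥`. So the value at `v` is eventually at least
`P v`, and the parent of `v` supplies exactly `P v`.

After that, `count` settles at `backCount P` from the leaves upwards, and `bcc` at the smallest path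
of the representative from the root downwards.
-/

/-! ### Sequences: lexicographic order and truncation -/

theorem List.IsPrefix.le_of_linearOrder {α : Type*} [LinearOrder α] {a b : List α} (h : a <+: b) :
    a ≤ b := by
  obtain ⟨t, rfl⟩ := h
  induction a with
  | nil => simpa using not_lt.1 (List.not_lt_nil t)
  | cons x xs ih => exact List.cons_le_cons x ih

theorem List.prefix_or_append_lt_append {α : Type*} [LinearOrder α] {a b : List α} (h : a < b) :
    a <+: b ∨ ∀ s t, a ++ s < b ++ t := by
  induction a generalizing b with
  | nil => exact .inl List.nil_prefix
  | cons x xs ih =>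
    cases b with
    | nil => exact absurd h (List.not_lt_nil _)
    | cons y ys =>
      rcases List.cons_lt_cons_iff.1 h with h1 | ⟨rfl, h1⟩
      · exact .inr fun s t => List.cons_lt_cons_iff.2 (.inl h1)
      · rcases ih h1 with h2 | h2
        · exact .inl ((List.prefix_cons_inj x).2 h2)
        · exact .inr fun s t => List.cons_lt_cons_iff.2 (.inr ⟨rfl, h2 s t⟩)

theorem List.rtake_eq_self {α : Type*} {l : List α} {n : ℕ} (h : l.length ≤ n) : l.rtake n = l := by
  simp [List.rtake, Nat.sub_eq_zero_of_le h]

theorem List.rtake_suffix {α : Type*} (l : List α) (n : ℕ) : l.rtake n <:+ l := List.drop_suffix _ _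

theorem List.length_rtake {α : Type*} (l : List α) (n : ℕ) :
    (l.rtake n).length = min n l.length := by
  simp only [List.rtake, List.length_drop]
  omega

namespace Network

open Filter

variable {V : Type*} [Fintype V] {net : Network V}

/-! ### Walks and their index sequences -/

theorem edgeIndex_ne_bot {u v : V} (h : net.graph.Adj u v) : net.edgeIndex h ≠ ⊥ :=
  WithBot.coe_ne_bot

theorem eq_of_edgeIndex_eq {u v w : V} {h : net.graph.Adj u v} {h' : net.graph.Adj u w}
    (e : net.edgeIndex h = net.edgeIndex h') : v = w := by
  have h1 : (net.port u ⟨v, h⟩ : ℕ) + 1 = (net.port u ⟨w, h'⟩ : ℕ) + 1 := WithBot.coe_injective e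
  have h2 := (net.port u).injective (Fin.ext (Nat.succ_injective h1))
  exact congrArg Subtype.val h2

theorem length_indices {u v : V} (p : net.graph.Walk u v) :
    (net.indices p).length = p.length := by
  induction p with
  | nil => rfl
  | cons h p ih => simp [indices, ih]

theorem bot_notMem_indices {u v : V} (p : net.graph.Walk u v) : ⊥ ∉ net.indices p := by
  induction p with
  | nil => simp [indices]
  | cons h p ih => simp [indices, ih, (edgeIndex_ne_bot h).symm]

theorem indices_append {u v w : V} (p : net.graph.Walk u v) (q : net.graph.Walk v w) :
    net.indices (p.append q) = net.indices p ++ net.indices q := by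
  induction p with
  | nil => rfl
  | cons h p ih => simp [indices, ih]

theorem indices_concat {u v w : V} (p : net.graph.Walk u v) (h : net.graph.Adj v w) :
    net.indices (p.concat h) = net.indices p ++ [net.edgeIndex h] := by
  rw [SimpleGraph.Walk.concat_eq_append, indices_append]; rfl

/-- A walk is determined by its first vertex and its index sequence. -/
theorem exists_eq_append_of_indices_prefix {u v w : V} (p : net.graph.Walk u v)
    (q : net.graph.Walk u w) (h : net.indices p <+: net.indices q) :
    ∃ r : net.graph.Walk v w, q = p.append r := by
  induction p with
  | nil => exact ⟨q, rfl⟩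
  | cons a p ih =>
    cases q with
    | nil => simp [indices] at h
    | cons b q =>
      obtain ⟨h1, h2⟩ := List.cons_prefix_cons.1 h
      obtain rfl := eq_of_edgeIndex_eq h1
      obtain ⟨r, rfl⟩ := ih q h2
      exact ⟨r, rfl⟩

theorem exists_isSmallestPath (hconn : net.graph.Connected) (v : V) :
    ∃ w, net.IsSmallestPath v w := by
  classical
  have hfin : (net.rootPaths v).Finite := by
    refine (Set.finite_range fun p : net.graph.Path net.root v => ⊥ :: net.indices p.1).subset ?_
    rintro _ ⟨p, hp, rfl⟩
    exact ⟨⟨p, hp⟩, rfl⟩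
  have hne : (net.rootPaths v).Nonempty := by
    obtain ⟨p⟩ := hconn.preconnected net.root v
    exact ⟨_, p.bypass, p.bypass_isPath, rfl⟩
  obtain ⟨w, hw⟩ := hfin.exists_minimal hne
  exact ⟨w, hw.1, fun x hx => (le_total w x).elim id (hw.2 hx)⟩

/-! ### The first depth-first search tree -/

section Tree

variable {P : V → PathValue} (hP : ∀ v, net.IsSmallestPath v (P v))
include hP

theorem smallestPath_root : P net.root = [⊥] := by
  obtain ⟨p, hp, h⟩ := (hP net.root).1
  rw [h, (SimpleGraph.Walk.isPath_iff_nil.1 hp).eq_nil]; rfl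

theorem smallestPath_eq_cons (v : V) : ∃ l, P v = ⊥ :: l ∧ ⊥ ∉ l := by
  obtain ⟨p, -, h⟩ := (hP v).1
  exact ⟨_, h, bot_notMem_indices p⟩

theorem length_smallestPath_le (v : V) : (P v).length ≤ Fintype.card V := by
  obtain ⟨p, hp, h⟩ := (hP v).1
  rw [h, List.length_cons, length_indices]
  exact hp.length_lt

theorem smallestPath_injective : Function.Injective P := by
  intro u v h
  obtain ⟨p, -, hu⟩ := (hP u).1
  obtain ⟨q, -, hv⟩ := (hP v).1
  have e : net.indices p = net.indices q := by
    have := hu.symm.trans (h.trans hv)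
    simpa using this
  obtain ⟨r, rfl⟩ := exists_eq_append_of_indices_prefix p q (e ▸ List.prefix_rfl)
  have : r.length = 0 := by
    have := congrArg List.length e
    simp only [indices_append, List.length_append, length_indices] at this
    omega
  exact SimpleGraph.Walk.eq_of_length_eq_zero this

/-- A smallest path without its last edge is again a smallest path. -/
theorem smallestPath_of_concat {u v : V} (q : net.graph.Walk net.root u) (h : net.graph.Adj u v)
    (hq : (q.concat h).IsPath) (e : P v = ⊥ :: net.indices (q.concat h)) :
    P u = ⊥ :: net.indices q := by
  classical
  have hq' := (SimpleGraph.Walk.concat_isPath_iff h).1 hq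
  obtain ⟨p, hp, hu⟩ := (hP u).1
  have hle : P u ≤ ⊥ :: net.indices q := (hP u).2 ⟨q, hq'.1, rfl⟩
  refine hle.eq_of_not_lt fun hlt => ?_
  have hlt0 := hlt
  rw [hu] at hlt
  rcases List.prefix_or_append_lt_append hlt with h1 | h1
  · obtain ⟨r, rfl⟩ := exists_eq_append_of_indices_prefix p q (List.cons_prefix_cons.1 h1).2
    have := (SimpleGraph.Walk.isPath_iff_nil.1 hq'.1.of_append_right).eq_nil
    subst this
    simp at hlt
  · by_cases hv : v ∈ p.support
    · -- the smallest path to `u` passes through `v`, and its part up to `v` is too small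
      have h2 : P v ≤ P u := by
        refine ((hP v).2 ⟨p.takeUntil v hv, hp.takeUntil hv, rfl⟩).trans ?_
        rw [hu]
        refine List.IsPrefix.le_of_linearOrder (List.cons_prefix_cons.2 ⟨rfl, ?_⟩)
        conv_rhs => rw [← p.take_spec hv, indices_append]
        exact List.prefix_append _ _
      have h3 : (⊥ :: net.indices q : PathValue) ≤ P v := by
        rw [e, indices_concat]
        exact List.IsPrefix.le_of_linearOrder (List.prefix_append _ _)
      exact absurd (h3.trans h2) (not_le.2 hlt0)
    · have h2 : P v ≤ ⊥ :: net.indices (p.concat h) :=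
        (hP v).2 ⟨_, (SimpleGraph.Walk.concat_isPath_iff h).2 ⟨hp, hv⟩, rfl⟩
      rw [e, indices_concat, indices_concat] at h2
      exact absurd h2 (not_le.2 (h1 [net.edgeIndex h] [net.edgeIndex h]))

theorem exists_parent {v : V} (hv : v ≠ net.root) :
    ∃ (u : V) (h : net.graph.Adj u v), P v = P u ++ [net.edgeIndex h] := by
  obtain ⟨p, hp, e⟩ := (hP v).1
  cases p with
  | nil => exact absurd rfl hv
  | cons h0 p =>
    obtain ⟨u, q, h, hq⟩ := SimpleGraph.Walk.exists_cons_eq_concat h0 p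
    rw [hq] at hp e
    refine ⟨u, h, ?_⟩
    rw [smallestPath_of_concat hP q h hp e, e, indices_concat]; rfl

/-- The nodes on the smallest path to `u` are ancestors of `u`. -/
theorem smallestPath_prefix_of_mem_support {u v : V} (p : net.graph.Walk net.root u)
    (hp : p.IsPath) (e : P u = ⊥ :: net.indices p) (hv : v ∈ p.support) : P v <+: P u := by
  generalize hn : p.length = n
  induction n generalizing u with
  | zero =>
    cases p with
    | nil => rw [List.mem_singleton.1 hv]
    | cons => simp at hn
  | succ n ih =>
    cases p with
    | nil => simp at hn
    | cons h0 p =>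
      obtain ⟨w, q, h, hq⟩ := SimpleGraph.Walk.exists_cons_eq_concat h0 p
      rw [hq] at hp e hv hn
      have hw := smallestPath_of_concat hP q h hp e
      rw [SimpleGraph.Walk.support_concat, List.mem_append,
        List.mem_singleton] at hv
      rcases hv with hv | rfl
      · have h1 := ih q ((SimpleGraph.Walk.concat_isPath_iff h).1 hp).1 hw hv
          (by simpa using hn)
        rw [e, indices_concat, ← List.cons_append, ← hw]
        exact h1.trans (List.prefix_append _ _)
      · exact List.prefix_rfl

theorem smallestPath_le_append {u v : V} (h : net.graph.Adj u v) (hlt : P u < P v) :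
    P v ≤ P u ++ [net.edgeIndex h] := by
  obtain ⟨p, hp, hu⟩ := (hP u).1
  have hv : v ∉ p.support := fun hv =>
    absurd (smallestPath_prefix_of_mem_support hP p hp hu hv).le_of_linearOrder (not_le.2 hlt)
  refine (hP v).2 ⟨p.concat h, (SimpleGraph.Walk.concat_isPath_iff h).2 ⟨hp, hv⟩, ?_⟩
  rw [hu, indices_concat]; rfl

/-- Every edge of the graph joins a node and one of its ancestors in the depth-first search tree. -/
theorem prefix_or_prefix_of_adj {u v : V} (h : net.graph.Adj u v) :
    P u <+: P v ∨ P v <+: P u := by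
  wlog hlt : P u < P v generalizing u v
  · rcases (not_lt.1 hlt).lt_or_eq with h1 | h1
    · exact (this h.symm h1).symm
    · exact .inl (h1 ▸ List.prefix_rfl)
  rcases List.prefix_or_append_lt_append hlt with h1 | h1
  · exact .inl h1
  · have := h1 [net.edgeIndex h] []
    rw [List.append_nil] at this
    exact absurd (smallestPath_le_append hP h hlt) (not_le.2 this)

theorem root_prefix (v : V) : P net.root <+: P v := by
  obtain ⟨l, h, -⟩ := smallestPath_eq_cons hP v
  rw [smallestPath_root hP, h]
  exact List.prefix_append [⊥] l

theorem ne_root_of_eq_append {u v : V} {a : WithBot ℕ} (h : P v = P u ++ [a]) :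
    v ≠ net.root := by
  rintro rfl
  obtain ⟨l, hl, -⟩ := smallestPath_eq_cons hP u
  rw [smallestPath_root hP, hl] at h
  simp at h

end Tree


/-! ### Back edges and bridges -/

/-- There is an edge from `w` up to its ancestor `y` which is not an edge of the depth-first search
tree, where `P v` is the smallest path of `v`. -/
def IsBackEdge (net : Network V) (P : V → PathValue) (w y : V) : Prop :=
  ∃ h : net.graph.Adj w y, P y <+: P w ∧ P w ≠ P y ++ [net.edgeIndex h.symm]

open Classical in
/-- The number of back edges that leave `w` upwards minus the number of those that reach `w` from
below. -/
noncomputable def backExcess (net : Network V) (P : V → PathValue) (w : V) : ℤ :=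
  ∑ y, ((if net.IsBackEdge P w y then 1 else 0) - (if net.IsBackEdge P y w then 1 else 0))

open Classical in
/-- The set of descendants of `v`. -/
noncomputable def descendants (P : V → PathValue) (v : V) : Finset V :=
  Finset.univ.filter fun w => P v <+: P w

theorem mem_descendants {P : V → PathValue} {v w : V} : w ∈ descendants P v ↔ P v <+: P w := by
  simp [descendants]

/-- The number of back edges from a descendant of `v` to a proper ancestor of `v`, expressed as a
sum over the descendants of `v`: a back edge with both ends below `v` contributes `1 - 1`. -/
noncomputable def backCount (net : Network V) (P : V → PathValue) (v : V) : ℤ :=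
  ∑ w ∈ descendants P v, net.backExcess P w

section Tree

variable {P : V → PathValue} (hP : ∀ v, net.IsSmallestPath v (P v))

open Classical in
theorem backCount_eq_sum_crossing (v : V) : net.backCount P v =
    ∑ w ∈ descendants P v, ∑ y ∈ (descendants P v)ᶜ,
      (if net.IsBackEdge P w y then (1 : ℤ) else 0) := by
  set S := descendants P v with hS
  let b : V → V → ℤ := fun w y => if net.IsBackEdge P w y then 1 else 0
  have hin : ∑ w ∈ S, ∑ y ∈ S, (b w y - b y w) = 0 := by
    simp only [Finset.sum_sub_distrib]
    rw [Finset.sum_comm, sub_self]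
  have hout : ∀ w ∈ S, ∀ y ∈ Sᶜ, b w y - b y w = b w y := by
    intro w hw y hy
    have : ¬ net.IsBackEdge P y w := by
      rintro ⟨-, h, -⟩
      exact (Finset.mem_compl.1 hy) (mem_descendants.2 ((mem_descendants.1 hw).trans h))
    simp [b, this]
  calc net.backCount P v = ∑ w ∈ S, (∑ y ∈ S, (b w y - b y w) + ∑ y ∈ Sᶜ, (b w y - b y w)) :=
        Finset.sum_congr rfl fun w _ => (Finset.sum_add_sum_compl S _).symm
    _ = ∑ w ∈ S, ∑ y ∈ Sᶜ, b w y := by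
        rw [Finset.sum_add_distrib, hin, zero_add]
        exact Finset.sum_congr rfl fun w hw => Finset.sum_congr rfl (hout w hw)

theorem backCount_eq_zero_iff (v : V) : net.backCount P v = 0 ↔
    ∀ w y, P v <+: P w → ¬ P v <+: P y → ¬ net.IsBackEdge P w y := by
  classical
  rw [backCount_eq_sum_crossing, Finset.sum_eq_zero_iff_of_nonneg fun w _ =>
    Finset.sum_nonneg fun y _ => by split_ifs <;> simp]
  constructor
  · intro h w y hw hy hb
    have h1 := h w (mem_descendants.2 hw)
    rw [Finset.sum_eq_zero_iff_of_nonneg fun y _ => by split_ifs <;> simp] at h1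
    have h2 := h1 y (by simpa [mem_descendants] using hy)
    simp [hb] at h2
  · intro h w hw
    refine Finset.sum_eq_zero fun y hy => if_neg (h w y (mem_descendants.1 hw) ?_)
    simpa [mem_descendants] using hy

theorem nbr_injective (v : V) : Function.Injective (net.nbr v) :=
  Subtype.val_injective.comp (net.port v).symm.injective

theorem exists_port {v w : V} (h : net.graph.Adj v w) :
    ∃ j, net.nbr v j = w ∧ net.ownIndex v j = net.edgeIndex h ∧
      net.farIndex v j = net.edgeIndex h.symm := by
  have e : net.nbr v (net.port v ⟨w, h⟩) = w := by simp [nbr]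
  refine ⟨net.port v ⟨w, h⟩, e, ?_, ?_⟩
  · simp only [ownIndex, e]
  · unfold farIndex
    congr 1

open Classical in
/-- What the link of `v` at port `j` contributes to the `count` field of `v`, when all `path` fields
are right and `cnt` gives the `count` fields of the children. -/
noncomputable def linkContribution (net : Network V) (P : V → PathValue) (cnt : V → ℤ) (v : V)
    (j : Fin (net.deg v)) : ℤ :=
  if P (net.nbr v j) = P v ++ [net.ownIndex v j] then cnt (net.nbr v j)
  else if P v <+: P (net.nbr v j) ∧ P (net.nbr v j) ≠ P v ++ [net.ownIndex v j] then -1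
  else if P (net.nbr v j) <+: P v ∧ P v ≠ P (net.nbr v j) ++ [net.farIndex v j] then 1
  else 0

include hP

open Classical in
theorem backExcess_eq_sum_ports (v : V) :
    net.backExcess P v = ∑ j, net.linkContribution P 0 v j := by
  have hne : ∀ j, P (net.nbr v j) ≠ P v := fun j h =>
    (net.adj_nbr v j).ne (smallestPath_injective hP h).symm
  have key : ∀ j, net.linkContribution P 0 v j =
      (if net.IsBackEdge P v (net.nbr v j) then (1 : ℤ) else 0) -
        (if net.IsBackEdge P (net.nbr v j) v then 1 else 0) := by
    intro j
    have h1 : net.IsBackEdge P v (net.nbr v j) ↔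
        P (net.nbr v j) <+: P v ∧ P v ≠ P (net.nbr v j) ++ [net.farIndex v j] :=
      ⟨fun h => h.2, fun h => ⟨net.adj_nbr v j, h⟩⟩
    have h2 : net.IsBackEdge P (net.nbr v j) v ↔
        P v <+: P (net.nbr v j) ∧ P (net.nbr v j) ≠ P v ++ [net.ownIndex v j] :=
      ⟨fun h => h.2, fun h => ⟨(net.adj_nbr v j).symm, h⟩⟩
    have h3 : P v <+: P (net.nbr v j) → ¬ P (net.nbr v j) <+: P v := fun h h' =>
      hne j (h'.eq_of_length_le h.length_le)
    unfold linkContribution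
    simp only [h1, h2]
    by_cases hc : P (net.nbr v j) = P v ++ [net.ownIndex v j]
    · have hn := h3 (hc ▸ List.prefix_append _ _)
      rw [if_pos hc, if_neg fun h => hn h.1, if_neg fun h => h.2 hc]; simp
    · by_cases hi : P v <+: P (net.nbr v j)
      · simp [hc, hi, h3 hi]
      · simp [hc, hi]
  rw [Finset.sum_congr rfl fun j _ => key j, backExcess]
  symm
  rw [← Finset.sum_image (s := Finset.univ) (g := net.nbr v)
    (f := fun y => (if net.IsBackEdge P v y then (1 : ℤ) else 0) -
        (if net.IsBackEdge P y v then 1 else 0)) fun a _ b _ h => nbr_injective v h]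
  refine Finset.sum_subset (Finset.subset_univ _) fun y _ hy => ?_
  have hadj : ¬ net.graph.Adj v y := fun h => by
    obtain ⟨j, hj, -⟩ := exists_port h
    exact hy (Finset.mem_image.2 ⟨j, Finset.mem_univ _, hj⟩)
  rw [if_neg fun ⟨h, _⟩ => hadj h, if_neg fun ⟨h, _⟩ => hadj h.symm, sub_zero]

/-- A proper descendant of `v` is a descendant of a child of `v`. -/
theorem exists_child_prefix {v w : V} (hw : P v <+: P w) (hne : w ≠ v) :
    ∃ j, P (net.nbr v j) = P v ++ [net.ownIndex v j] ∧ P (net.nbr v j) <+: P w := by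
  generalize hn : (P w).length = n
  induction n using Nat.strong_induction_on generalizing w with
  | _ n ih =>
  have hroot : w ≠ net.root := by
    rintro rfl
    exact hne (smallestPath_injective hP
      ((root_prefix hP v).eq_of_length_le hw.length_le))
  obtain ⟨u, h, e⟩ := exists_parent hP hroot
  rcases eq_or_ne u v with rfl | huv
  · obtain ⟨j, hj, ho, -⟩ := exists_port h
    exact ⟨j, by rw [hj, ho, e], by rw [hj]⟩
  · rw [e, List.prefix_concat_iff] at hw
    rcases hw with hw | hw
    · exact absurd (smallestPath_injective hP (e.trans hw.symm)) hne
    · obtain ⟨j, h1, h2⟩ := ih _ (by rw [← hn, e]; simp) hw huv rfl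
      exact ⟨j, h1, h2.trans (e ▸ List.prefix_append _ _)⟩

/-- The recursion that the algorithm uses to compute `backCount` from the leaves upwards. -/
theorem backCount_eq_sum_ports (v : V) :
    net.backCount P v = ∑ j, net.linkContribution P (net.backCount P) v j := by
  classical
  set K : Finset (Fin (net.deg v)) :=
    Finset.univ.filter fun j => P (net.nbr v j) = P v ++ [net.ownIndex v j] with hK
  have hdec : descendants P v =
      insert v (K.biUnion fun j => descendants P (net.nbr v j)) := by
    ext w
    simp only [mem_descendants, Finset.mem_insert, Finset.mem_biUnion, hK, Finset.mem_filter,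
      Finset.mem_univ, true_and]
    constructor
    · intro h
      by_cases hw : w = v
      · exact .inl hw
      · exact .inr (exists_child_prefix hP h hw)
    · rintro (rfl | ⟨j, hj, h⟩)
      · exact List.prefix_rfl
      · exact (hj ▸ List.prefix_append _ _ : P v <+: P (net.nbr v j)).trans h
  have hnot : v ∉ K.biUnion fun j => descendants P (net.nbr v j) := by
    simp only [Finset.mem_biUnion, mem_descendants, not_exists, not_and, hK, Finset.mem_filter]
    intro j hj h
    have := h.length_le
    rw [hj.2, List.length_append] at this
    simp at this
  have hdisj : (K : Set (Fin (net.deg v))).PairwiseDisjoint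
      fun j => descendants P (net.nbr v j) := by
    intro i hi j hj hij
    refine Finset.disjoint_left.2 fun w hwi hwj => hij ?_
    have hi' := (Finset.mem_filter.1 hi).2
    have hj' := (Finset.mem_filter.1 hj).2
    have := List.prefix_of_prefix_length_le (mem_descendants.1 hwi) (mem_descendants.1 hwj)
      (by rw [hi', hj']; simp)
    exact nbr_injective v (smallestPath_injective hP
      (this.eq_of_length (by rw [hi', hj']; simp)))
  have hsplit : ∀ j, net.linkContribution P (net.backCount P) v j =
      net.linkContribution P 0 v j + if P (net.nbr v j) = P v ++ [net.ownIndex v j] then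
        net.backCount P (net.nbr v j) else 0 := by
    intro j
    unfold linkContribution
    by_cases h : P (net.nbr v j) = P v ++ [net.ownIndex v j]
    · simp only [if_pos h]; simp
    · simp only [if_neg h, add_zero]
  rw [Finset.sum_congr rfl fun j _ => hsplit j, Finset.sum_add_distrib,
    ← backExcess_eq_sum_ports hP, ← Finset.sum_filter, ← hK]
  conv_lhs => rw [backCount, hdec, Finset.sum_insert hnot, Finset.sum_biUnion hdisj]
  rfl

/-- Tree edges other than the one from `v` to its parent connect `v` with its descendants, and the
root with all other nodes. -/
theorem reachable_deleteEdges {u v : V} (h : net.graph.Adj u v)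
    (e : P v = P u ++ [net.edgeIndex h]) (w : V) :
    (net.graph.deleteEdges {s(u, v)}).Reachable (if P v <+: P w then v else net.root) w := by
  generalize hn : (P w).length = n
  induction n using Nat.strong_induction_on generalizing w with
  | _ n ih =>
  rcases eq_or_ne w v with rfl | hwv
  · simp
  rcases eq_or_ne w net.root with rfl | hroot
  · rw [if_neg fun hpre => hwv (smallestPath_injective hP
      ((root_prefix hP v).eq_of_length_le hpre.length_le))]
  obtain ⟨x, hx, ex⟩ := exists_parent hP hroot
  have h1 := ih _ (by rw [← hn, ex]; simp) x rfl
  have h2 : (P v <+: P x) ↔ (P v <+: P w) := by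
    rw [ex, List.prefix_concat_iff]
    refine ⟨.inr, fun h => h.resolve_left fun h' => hwv ?_⟩
    exact smallestPath_injective hP (ex.trans h'.symm)
  rw [if_congr h2 rfl rfl] at h1
  refine h1.trans (SimpleGraph.Adj.reachable ?_)
  rw [SimpleGraph.deleteEdges_adj]
  refine ⟨hx, ?_⟩
  rw [Set.mem_singleton_iff, Sym2.eq_iff]
  rintro (⟨-, rfl⟩ | ⟨rfl, rfl⟩)
  · exact hwv rfl
  · have := congrArg List.length e
    rw [ex] at this
    simp at this

/-- The edges that leave the subtree of `v` are back edges, except for the edge from `v` to its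
parent. -/
theorem isBackEdge_or_eq_of_crossing {u v w y : V} (h : net.graph.Adj u v)
    (e : P v = P u ++ [net.edgeIndex h]) (hwy : net.graph.Adj w y) (hw : P v <+: P w)
    (hy : ¬ P v <+: P y) : net.IsBackEdge P w y ∨ (w = v ∧ y = u) := by
  have h1 : P y <+: P w := (prefix_or_prefix_of_adj hP hwy).resolve_left fun h => hy (hw.trans h)
  by_cases h2 : P w = P y ++ [net.edgeIndex hwy.symm]
  · right
    rw [h2, List.prefix_concat_iff] at hw
    have h3 := hw.resolve_right hy
    refine ⟨smallestPath_injective hP (h2.trans h3.symm), smallestPath_injective hP ?_⟩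
    rw [e] at h3
    exact (List.append_inj' h3 rfl).1.symm
  · exact .inl ⟨hwy, h1, h2⟩

theorem isBridge_iff_backCount_eq_zero {u v : V} (h : net.graph.Adj u v)
    (e : P v = P u ++ [net.edgeIndex h]) :
    net.graph.IsBridge s(u, v) ↔ net.backCount P v = 0 := by
  have hu : ¬ P v <+: P u := fun hpre => by
    have := hpre.length_le
    rw [e] at this
    simp at this
  rw [SimpleGraph.isBridge_iff, backCount_eq_zero_iff]
  constructor
  · intro hb w y hw hy hwy
    refine hb ?_
    have h1 := reachable_deleteEdges hP h e w
    have h2 := reachable_deleteEdges hP h e y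
    have h3 := reachable_deleteEdges hP h e u
    rw [if_pos hw] at h1
    rw [if_neg hy] at h2
    rw [if_neg hu] at h3
    refine h3.symm.trans (h2.trans (SimpleGraph.Reachable.trans (SimpleGraph.Adj.reachable ?_)
      h1.symm))
    rw [SimpleGraph.deleteEdges_adj]
    refine ⟨hwy.1.symm, ?_⟩
    rw [Set.mem_singleton_iff, Sym2.eq_iff]
    rintro (⟨rfl, rfl⟩ | ⟨rfl, rfl⟩)
    · exact hwy.2.2 e
    · exact hy List.prefix_rfl
  · intro hno hreach
    -- without back edges the subtree of `v` is closed under the remaining edges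
    have hcl : ∀ a b, (net.graph.deleteEdges {s(u, v)}).Walk a b → P v <+: P a → P v <+: P b := by
      intro a b p
      induction p with
      | nil => exact id
      | cons hadj p ih =>
        refine fun ha => ih (by_contra fun hb => ?_)
        rw [SimpleGraph.deleteEdges_adj] at hadj
        rcases isBackEdge_or_eq_of_crossing hP h e hadj.1 ha hb with h1 | ⟨rfl, rfl⟩
        · exact hno _ _ ha hb h1
        · exact hadj.2 Sym2.eq_swap
    obtain ⟨p⟩ := hreach.symm
    exact hu (hcl _ _ p List.prefix_rfl)

/-! ### Representative nodes -/

theorem isAncestor_iff {u v : V} : net.IsAncestor u v ↔ P u <+: P v := by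
  constructor
  · rintro ⟨a, b, ha, hb, h⟩
    rwa [IsLeast.unique (hP u) ha, IsLeast.unique (hP v) hb]
  · exact fun h => ⟨_, _, hP u, hP v, h⟩

theorem isRepresentative_unique {u u' v : V} (h : net.IsRepresentative u v)
    (h' : net.IsRepresentative u' v) : u = u' := by
  have h1 := (isAncestor_iff hP).1 (h.2 u' h'.1)
  have h2 := (isAncestor_iff hP).1 (h'.2 u h.1)
  exact smallestPath_injective hP (h1.eq_of_length_le h2.length_le)

theorem isRepresentative_root : net.IsRepresentative net.root net.root :=
  ⟨SimpleGraph.Reachable.refl _, fun w _ => (isAncestor_iff hP).2 (root_prefix hP w)⟩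

/-- A node below a bridge represents its component: the component cannot leave its subtree. -/
theorem isRepresentative_self {v : V} (hv : v ≠ net.root) (h0 : net.backCount P v = 0) :
    net.IsRepresentative v v := by
  obtain ⟨u, h, e⟩ := exists_parent hP hv
  have hb : s(u, v) ∈ {e | net.graph.IsBridge e} :=
    (isBridge_iff_backCount_eq_zero hP h e).2 h0
  refine ⟨SimpleGraph.Reachable.refl _, fun w hw => (isAncestor_iff hP).2 ?_⟩
  have h1 := (hw.symm.mono (SimpleGraph.deleteEdges_anti
    (Set.singleton_subset_iff.2 hb)) : (net.graph.deleteEdges {s(u, v)}).Reachable v w)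
  by_contra hn
  have h2 := reachable_deleteEdges hP h e w
  have h3 := reachable_deleteEdges hP h e u
  rw [if_neg hn] at h2
  rw [if_neg fun hpre => by
    have := hpre.length_le
    rw [e] at this
    simp at this] at h3
  exact (SimpleGraph.isBridge_iff.1 hb) (h3.symm.trans (h2.trans h1.symm))

theorem isRepresentative_of_parent {u v r : V} (h : net.graph.Adj u v)
    (e : P v = P u ++ [net.edgeIndex h]) (h0 : net.backCount P v ≠ 0)
    (hr : net.IsRepresentative r u) : net.IsRepresentative r v := by
  have huv : net.SameComponent u v := by
    refine SimpleGraph.Adj.reachable ?_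
    rw [SimpleGraph.deleteEdges_adj]
    exact ⟨h, fun hb => h0 ((isBridge_iff_backCount_eq_zero hP h e).1 hb)⟩
  exact ⟨hr.1.trans huv, fun w hw => hr.2 w (SimpleGraph.Reachable.trans hw huv.symm)⟩

theorem exists_isRepresentative (v : V) : ∃ r, net.IsRepresentative r v := by
  generalize hn : (P v).length = n
  induction n using Nat.strong_induction_on generalizing v with
  | _ n ih =>
  rcases eq_or_ne v net.root with rfl | hv
  · exact ⟨_, isRepresentative_root hP⟩
  by_cases h0 : net.backCount P v = 0
  · exact ⟨v, isRepresentative_self hP hv h0⟩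
  obtain ⟨u, h, e⟩ := exists_parent hP hv
  obtain ⟨r, hr⟩ := ih _ (by rw [← hn, e]; simp) u rfl
  exact ⟨r, isRepresentative_of_parent hP h e h0 hr⟩

end Tree


/-! ### The atomic steps of a processor -/

/-- The transition relation of a non-root processor `v` with at least one neighbour: with the
registers `reg`, an atomic step takes the local state `s` to `s'` and leaves the register of `v`
with content `r'`. There is one constructor for each read or write of the program. -/
inductive LocalStep (net : Network V) (v : V) (reg : V → Register) (s : NodeState (net.deg v)) :
    NodeState (net.deg v) → Register → Prop
  | readPath (j : Fin (net.deg v))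
      (h : s.pc = .pathLoop j.castSucc ∨ (j : ℕ) = 0 ∧ ((∃ i, s.pc = .wroteBcc i) ∨
        s.pc = .testCount ∧ s.count ≠ 0 ∧ ∀ i, s.path ≠ s.readPath i ++ [net.farIndex v i])) :
      LocalStep net v reg s
        { s with
          readPath := Function.update s.readPath j (reg (net.nbr v j)).path
          pc := .pathLoop j.succ } (reg v)
  | writePath (h : s.pc = .pathLoop (Fin.last _)) :
      LocalStep net v reg s { s with pc := .loadPath } { reg v with path := net.newPath v s }
  | loadPath (h : s.pc = .loadPath) :
      LocalStep net v reg s { s with path := (reg v).path, pc := .initCount } (reg v)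
  | readCount (k : ℕ) (c c' : ℤ) (j : Fin (net.deg v))
      (h : s.pc = .initCount ∧ k = 0 ∧ c = 0 ∨
        ∃ i, s.pc = .gotCount i ∧ k = i + 1 ∧ c = s.count + s.readCount i)
      (hscan : net.scanCount v s (portsFrom (net.deg v) k) c = (c', some j)) :
      LocalStep net v reg s
        { s with
          count := c'
          readCount := Function.update s.readCount j (reg (net.nbr v j)).count
          pc := .gotCount j } (reg v)
  | writeCount (k : ℕ) (c c' : ℤ)
      (h : s.pc = .initCount ∧ k = 0 ∧ c = 0 ∨
        ∃ i, s.pc = .gotCount i ∧ k = i + 1 ∧ c = s.count + s.readCount i)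
      (hscan : net.scanCount v s (portsFrom (net.deg v) k) c = (c', none)) :
      LocalStep net v reg s { s with count := c', pc := .loadCount } { reg v with count := c' }
  | loadCount (h : s.pc = .loadCount) :
      LocalStep net v reg s { s with count := (reg v).count, pc := .reloadPath } (reg v)
  | reloadPath (h : s.pc = .reloadPath) :
      LocalStep net v reg s { s with path := (reg v).path, pc := .testCount } (reg v)
  | writeOwnBcc (h : s.pc = .testCount) (h0 : s.count = 0) :
      LocalStep net v reg s { s with pc := .pathLoop 0 } { reg v with bcc := s.path }
  | readBcc (j : Fin (net.deg v))
      (h : s.pc = .testCount ∧ s.count ≠ 0 ∨ ∃ i, s.pc = .wroteBcc i ∧ i < j)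
      (hj : s.path = s.readPath j ++ [net.farIndex v j]) :
      LocalStep net v reg s
        { s with
          readBcc := Function.update s.readBcc j (reg (net.nbr v j)).bcc
          pc := .gotBcc j } (reg v)
  | writeBcc (j : Fin (net.deg v)) (h : s.pc = .gotBcc j) :
      LocalStep net v reg s { s with pc := .wroteBcc j } { reg v with bcc := s.readBcc j }

theorem val_ge_of_mem_portsFrom {d k : ℕ} {j : Fin d} (h : j ∈ portsFrom d k) : k ≤ j := by
  obtain ⟨i, hi, rfl⟩ := List.mem_iff_getElem.1 h
  simp [portsFrom]

theorem portsFrom_zero (d : ℕ) : portsFrom d 0 = List.finRange d := by simp [portsFrom]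

/-- In a decomposition of the list of the remaining ports, the entry `j` is followed by the ports
greater than `j`. -/
theorem eq_portsFrom_of_portsFrom_eq_append {d k : ℕ} {pre post : List (Fin d)} {j : Fin d}
    (h : portsFrom d k = pre ++ j :: post) : post = portsFrom d (j + 1) := by
  have hlen : pre.length < (portsFrom d k).length := by rw [h]; simp
  have hj : (j : ℕ) = k + pre.length := by
    have h1 : (portsFrom d k)[pre.length] = j := by simp [h]
    rw [← h1]; simp [portsFrom]
  have h2 : (portsFrom d k).drop (pre.length + 1) = post := by simp [h]
  rw [← h2, portsFrom, List.drop_drop, portsFrom, hj]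
  congr 1

section Node

variable {v : V} (hd : 0 < net.deg v)
include hd

theorem localStep_bccStep (reg : V → Register) (s : NodeState (net.deg v)) (k : ℕ)
    (h : s.pc = .testCount ∧ s.count ≠ 0 ∧ k = 0 ∨ ∃ i, s.pc = .wroteBcc i ∧ k = i + 1) :
    net.LocalStep v reg s (net.bccStep v reg s (portsFrom (net.deg v) k)).1
      (net.bccStep v reg s (portsFrom (net.deg v) k)).2 := by
  unfold bccStep
  split
  · rename_i j hj
    refine .readBcc j ?_ (by simpa using List.find?_some hj)
    rcases h with ⟨h1, h2, -⟩ | ⟨i, h1, rfl⟩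
    · exact .inl ⟨h1, h2⟩
    · exact .inr ⟨i, h1, val_ge_of_mem_portsFrom (List.mem_of_find?_eq_some hj)⟩
  · rename_i hnone
    have h0 : ((0 : Fin (net.deg v + 1)) : ℕ) < net.deg v := hd
    rw [pathStep, dif_pos h0]
    refine .readPath ⟨0, hd⟩ (.inr ⟨rfl, ?_⟩)
    rcases h with ⟨h1, h2, rfl⟩ | ⟨i, h1, rfl⟩
    · refine .inr ⟨h1, h2, fun i => ?_⟩
      rw [portsFrom_zero] at hnone
      simpa using List.find?_eq_none.1 hnone i (List.mem_finRange i)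
    · exact .inl ⟨i, h1⟩

theorem localStep_nodeStep (reg : V → Register) (s : NodeState (net.deg v)) :
    net.LocalStep v reg s (net.nodeStep v reg s).1 (net.nodeStep v reg s).2 := by
  have hcount : ∀ (k : ℕ) (c : ℤ), (s.pc = .initCount ∧ k = 0 ∧ c = 0 ∨
      ∃ i, s.pc = .gotCount i ∧ k = i + 1 ∧ c = s.count + s.readCount i) →
      net.LocalStep v reg s (net.countStep v reg s (portsFrom (net.deg v) k) c).1
        (net.countStep v reg s (portsFrom (net.deg v) k) c).2 := by
    intro k c h
    unfold countStep
    split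
    · rename_i c' j hj
      exact .readCount k c c' j h hj
    · rename_i c' hj
      exact .writeCount k c c' h hj
  unfold nodeStep
  split
  · rename_i j hj
    unfold pathStep
    split
    · rename_i h
      exact .readPath ⟨j, h⟩ (.inl hj)
    · rename_i h
      refine .writePath (hj.trans (congrArg _ (Fin.ext ?_)))
      have := j.2
      simp only [Fin.val_last]
      omega
  · exact .loadPath ‹_›
  · exact hcount 0 0 (.inl ⟨‹_›, rfl, rfl⟩)
  · rename_i j hj
    exact hcount _ _ (.inr ⟨j, hj, rfl, rfl⟩)
  · exact .loadCount ‹_›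
  · exact .reloadPath ‹_›
  · rename_i hpc
    split
    · exact .writeOwnBcc hpc ‹_›
    · exact localStep_bccStep hd reg s 0 (.inl ⟨hpc, ‹_›, rfl⟩)
  · exact .writeBcc _ ‹_›
  · rename_i j hj
    exact localStep_bccStep hd reg s _ (.inr ⟨j, hj, rfl⟩)

end Node

/-- The position of the program counter in the cycle that begins after the write of `path`. -/
def _root_.NodePC.position {d : ℕ} : NodePC d → ℕ
  | .loadPath => 0
  | .initCount => 1
  | .gotCount j => j + 2
  | .loadCount => d + 2
  | .reloadPath => d + 3
  | .testCount => d + 4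
  | .gotBcc j => d + 5 + 2 * j
  | .wroteBcc j => d + 6 + 2 * j
  | .pathLoop j => 3 * d + 5 + j

theorem _root_.NodePC.position_le {d : ℕ} (pc : NodePC d) : pc.position ≤ 4 * d + 5 := by
  cases pc <;> simp only [NodePC.position] <;> omega

theorem mem_of_scanCount_eq_some {v : V} {s : NodeState (net.deg v)} {js : List (Fin (net.deg v))}
    {c c' : ℤ} {j : Fin (net.deg v)} (h : net.scanCount v s js c = (c', some j)) : j ∈ js := by
  induction js generalizing c with
  | nil => simp [scanCount] at h
  | cons i js ih =>
    unfold scanCount at h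
    split_ifs at h
    · simp only [Prod.mk.injEq, Option.some.injEq] at h
      exact h.2 ▸ List.mem_cons_self
    all_goals exact List.mem_cons_of_mem _ (ih h)

theorem LocalStep.position_lt {v : V} {reg : V → Register} {s s' : NodeState (net.deg v)}
    {r' : Register} (h : net.LocalStep v reg s s' r') (hs : s.pc ≠ .pathLoop (Fin.last _)) :
    s.pc.position < s'.pc.position := by
  cases h with
  | readPath j h =>
    rcases h with h | ⟨h0, ⟨i, h⟩ | ⟨h, -⟩⟩ <;> simp only [h, NodePC.position, Fin.val_castSucc,
      Fin.val_succ] <;> omega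
  | writePath h => exact absurd h hs
  | readCount k c c' j h hscan =>
    have := val_ge_of_mem_portsFrom (mem_of_scanCount_eq_some hscan)
    rcases h with ⟨h, -⟩ | ⟨i, h, rfl, -⟩ <;> simp only [h, NodePC.position] <;> omega
  | writeCount k c c' h hscan =>
    rcases h with ⟨h, -⟩ | ⟨i, h, rfl, -⟩ <;> simp only [h, NodePC.position] <;> omega
  | readBcc j h hj =>
    rcases h with ⟨h, -⟩ | ⟨i, h, hi⟩ <;> simp only [h, NodePC.position] <;> omega
  | loadPath h | loadCount h | reloadPath h => simp only [h, NodePC.position]; omega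
  | writeOwnBcc h => simp only [h, NodePC.position, Fin.val_zero]; omega
  | writeBcc j h => simp only [h, NodePC.position]; omega

/-! ### Fair executions -/

section Execution

variable [DecidableEq V] {sched : ℕ → V} {c : ℕ → net.Config}

/-- A quantity that only changes when `v` is activated keeps its value until the next activation. -/
theorem IsFairExecution.exists_activation (hex : net.IsFairExecution sched c) {α : Type*} (v : V)
    (f : ℕ → α) (hf : ∀ t, sched t ≠ v → f (t + 1) = f t) (k : ℕ) :
    ∃ t, k ≤ t ∧ sched t = v ∧ f t = f k := by
  classical
  have hex' : ∃ t, k ≤ t ∧ sched t = v := by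
    obtain ⟨t, ht, hkt⟩ := (hex.2 v).exists_gt k
    exact ⟨t, hkt.le, ht⟩
  refine ⟨Nat.find hex', (Nat.find_spec hex').1, (Nat.find_spec hex').2, ?_⟩
  have key : ∀ m, k + m ≤ Nat.find hex' → f (k + m) = f k := by
    intro m
    induction m with
    | zero => intro _; rfl
    | succ m ih =>
      intro hm
      have h1 : sched (k + m) ≠ v := fun h =>
        Nat.find_min hex' (m := k + m) (by omega) ⟨by omega, h⟩
      rw [← add_assoc, hf _ h1]
      exact ih (by omega)
  obtain ⟨m, hm⟩ := Nat.exists_eq_add_of_le (Nat.find_spec hex').1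
  rw [hm]
  exact key m hm.ge

theorem IsExecution.localStep (hex : net.IsExecution sched c) {v : V} (hv : v ≠ net.root)
    (hd : 0 < net.deg v) {t : ℕ} (ht : sched t = v) :
    net.LocalStep v (c t).reg ((c t).node ⟨v, hv⟩) ((c (t + 1)).node ⟨v, hv⟩)
      ((c (t + 1)).reg v) := by
  have h := localStep_nodeStep hd (c t).reg ((c t).node ⟨v, hv⟩)
  have e : c (t + 1) = net.step v (c t) := ht ▸ hex t
  rw [e, step, dif_neg hv]
  simpa using h

theorem IsExecution.node_eq (hex : net.IsExecution sched c) {v : V} (hv : v ≠ net.root)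
    {t : ℕ} (ht : sched t ≠ v) : (c (t + 1)).node ⟨v, hv⟩ = (c t).node ⟨v, hv⟩ := by
  rw [hex t, step]
  split
  · rfl
  · exact Function.update_of_ne (fun h => ht (congrArg Subtype.val h).symm) _ _

theorem IsExecution.reg_eq (hex : net.IsExecution sched c) {v : V} {t : ℕ} (ht : sched t ≠ v) :
    (c (t + 1)).reg v = (c t).reg v := by
  rw [hex t, step]
  split <;> exact Function.update_of_ne ht.symm _ _

/-- A processor writes its `path` field infinitely often: the program always gets there. -/
theorem IsFairExecution.exists_writePath (hex : net.IsFairExecution sched c) {v : V}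
    (hv : v ≠ net.root) (hd : 0 < net.deg v) (k : ℕ) :
    ∃ t, k ≤ t ∧ sched t = v ∧ ((c t).node ⟨v, hv⟩).pc = .pathLoop (Fin.last _) := by
  -- induction on the number of positions that are still ahead
  obtain ⟨n, hn⟩ : ∃ n, 4 * net.deg v + 5 - ((c k).node ⟨v, hv⟩).pc.position ≤ n := ⟨_, le_rfl⟩
  induction n using Nat.strong_induction_on generalizing k with
  | _ n ih =>
  obtain ⟨t, hkt, ht, hst⟩ := hex.exists_activation v (fun t => (c t).node ⟨v, hv⟩)
    (fun _ h => hex.1.node_eq hv h) k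
  by_cases hlast : ((c t).node ⟨v, hv⟩).pc = .pathLoop (Fin.last _)
  · exact ⟨t, hkt, ht, hlast⟩
  · have h1 := (hex.1.localStep hv hd ht).position_lt hlast
    have h2 := NodePC.position_le (d := net.deg v) ((c (t + 1)).node ⟨v, hv⟩).pc
    rw [show (c t).node ⟨v, hv⟩ = _ from hst] at h1
    obtain ⟨t', h3, h4⟩ := ih _ (by omega) (t + 1) le_rfl
    exact ⟨t', by omega, h4⟩

/-- The principle behind all convergence proofs. Let `J` be preserved by the steps of `v` from some
time on (using eventually valid facts `E` about the configuration), and let it hold trivially when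
`v` is about to load `path`. Then it holds from then on, hence also at the end of a complete cycle
of the program. If it implies there that the write of `path` establishes `J'`, and `J'` is
preserved as well, then `J'` eventually holds forever. -/
theorem IsFairExecution.eventually_of_cycle (hex : net.IsFairExecution sched c) {v : V}
    (hv : v ≠ net.root) (hd : 0 < net.deg v) {E : (V → Register) → NodeState (net.deg v) → Prop}
    (hE : ∀ᶠ t in atTop, E (c t).reg ((c t).node ⟨v, hv⟩))
    (J J' : NodeState (net.deg v) → Register → Prop)
    (h0 : ∀ s r, s.pc = .loadPath → J s r)
    (hJ : ∀ reg s s' r', E reg s → net.LocalStep v reg s s' r' → J s (reg v) → J s' r')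
    (h1 : ∀ reg s s' r', E reg s → net.LocalStep v reg s s' r' →
      s.pc = .pathLoop (Fin.last _) → J s (reg v) → J' s' r')
    (hJ' : ∀ reg s s' r', E reg s → net.LocalStep v reg s s' r' → J' s (reg v) → J' s' r') :
    ∀ᶠ t in atTop, J' ((c t).node ⟨v, hv⟩) ((c t).reg v) := by
  obtain ⟨k, hk⟩ := hE.exists_forall_of_atTop
  have stable : ∀ K : NodeState (net.deg v) → Register → Prop,
      (∀ reg s s' r', E reg s → net.LocalStep v reg s s' r' → K s (reg v) → K s' r') →
      ∀ t₀, k ≤ t₀ → K ((c t₀).node ⟨v, hv⟩) ((c t₀).reg v) →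
      ∀ t, t₀ ≤ t → K ((c t).node ⟨v, hv⟩) ((c t).reg v) := by
    intro K hK t₀ hkt h t ht
    induction t, ht using Nat.le_induction with
    | base => exact h
    | succ t ht ih =>
      by_cases hs : sched t = v
      · exact hK _ _ _ _ (hk t (hkt.trans ht)) (hex.1.localStep hv hd hs) ih
      · rw [hex.1.node_eq hv hs, hex.1.reg_eq hs]
        exact ih
  obtain ⟨t, hkt, ht, hpc⟩ := hex.exists_writePath hv hd k
  have hload : ((c (t + 1)).node ⟨v, hv⟩).pc = .loadPath := by
    have hstep := hex.1.localStep hv hd ht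
    revert hstep
    generalize (c (t + 1)).node ⟨v, hv⟩ = s'
    generalize (c (t + 1)).reg v = r'
    intro hstep
    cases hstep <;> simp_all [Fin.ext_iff]
    omega
  have hJall := stable J hJ (t + 1) (by omega) (h0 _ _ hload)
  obtain ⟨t', hkt', ht', hpc'⟩ := hex.exists_writePath hv hd (t + 1)
  have h2 := h1 _ _ _ _ (hk t' (by omega)) (hex.1.localStep hv hd ht') hpc' (hJall t' hkt')
  exact eventually_atTop.2 ⟨t' + 1, stable J' hJ' (t' + 1) (by omega) h2⟩

theorem IsExecution.root_eq (hex : net.IsExecution sched c) {t : ℕ} (ht : sched t = net.root) :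
    (c (t + 1)).rootPC = (rootStep ((c t).reg net.root) (c t).rootPC).1 ∧
      (c (t + 1)).reg net.root = (rootStep ((c t).reg net.root) (c t).rootPC).2 := by
  have e : c (t + 1) = net.step net.root (c t) := ht ▸ hex t
  rw [e, step, dif_pos rfl]
  simp

theorem IsFairExecution.exists_rootPC (hex : net.IsFairExecution sched c) (pc : RootPC) (k : ℕ) :
    ∃ t, k ≤ t ∧ sched t = net.root ∧ (c t).rootPC = pc := by
  have next : ∀ k, ∃ t, k ≤ t ∧ sched t = net.root ∧ (c t).rootPC = (c k).rootPC :=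
    hex.exists_activation net.root (fun t => (c t).rootPC) fun t ht => by
      simp only [hex.1 t, step, dif_neg ht]
  have succ : ∀ k, ∃ t, k ≤ t ∧ (c t).rootPC = (rootStep ((c k).reg net.root) (c k).rootPC).1 := by
    intro k
    obtain ⟨t, hkt, ht, hpc⟩ := next k
    refine ⟨t + 1, by omega, ?_⟩
    rw [(hex.1.root_eq ht).1, hpc]
    cases (c k).rootPC <;> rfl
  obtain ⟨t₁, h₁, e₁⟩ := succ k
  obtain ⟨t₂, h₂, e₂⟩ := succ t₁
  have : (c k).rootPC = pc ∨ (c t₁).rootPC = pc ∨ (c t₂).rootPC = pc := by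
    rw [e₂, e₁]
    cases (c k).rootPC <;> cases pc <;> simp [rootStep]
  rcases this with h | h | h
  · obtain ⟨t, ht, h3, h4⟩ := next k
    exact ⟨t, ht, h3, h4.trans h⟩
  · obtain ⟨t, ht, h3, h4⟩ := next t₁
    exact ⟨t, by omega, h3, h4.trans h⟩
  · obtain ⟨t, ht, h3, h4⟩ := next t₂
    exact ⟨t, by omega, h3, h4.trans h⟩

theorem IsFairExecution.eventually_root (hex : net.IsFairExecution sched c) :
    ∀ᶠ t in atTop, ((c t).reg net.root).path = [⊥] ∧ ((c t).reg net.root).bcc = [⊥] := by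
  have stable : ∀ K : Register → Prop, (∀ r pc, K r → K (rootStep r pc).2) →
      ∀ pc, (∀ r, K (rootStep r pc).2) → ∀ᶠ t in atTop, K ((c t).reg net.root) := by
    intro K hK pc hpc
    obtain ⟨t₀, -, h1, h2⟩ := hex.exists_rootPC pc 0
    refine eventually_atTop.2 ⟨t₀ + 1, fun t ht => ?_⟩
    induction t, ht using Nat.le_induction with
    | base =>
      rw [(hex.1.root_eq h1).2, h2]
      exact hpc _
    | succ t ht ih =>
      by_cases hs : sched t = net.root
      · rw [(hex.1.root_eq hs).2]
        exact hK _ _ ih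
      · rw [hex.1.reg_eq hs]
        exact ih
  refine (stable (fun r => r.path = [⊥]) ?_ .writePath fun r => rfl).and
    (stable (fun r => r.bcc = [⊥]) ?_ .writeBcc fun r => rfl)
  · rintro r (_ | _ | _) h <;> simp_all [rootStep]
  · rintro r (_ | _ | _) h <;> simp_all [rootStep]

end Execution


/-! ### Admissible path values -/

/-- A sequence is admissible for the lower bound `L` if it is at least `L` and contains `⊥` at most
as its first symbol. The second condition makes the first one survive truncation from the left. -/
def IsAdmissible (L x : PathValue) : Prop := L ≤ x ∧ ⊥ ∉ x.tail

theorem isAdmissible_of_bot_notMem {l x : PathValue} (hx : x ≠ []) (h : ⊥ ∉ x) :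
    IsAdmissible (⊥ :: l) x := by
  refine ⟨?_, fun h' => h (List.mem_of_mem_tail h')⟩
  cases x with
  | nil => exact absurd rfl hx
  | cons y ys =>
    have : ⊥ < y := bot_lt_iff_ne_bot.2 fun e => h (e ▸ List.mem_cons_self)
    exact le_of_lt (List.cons_lt_cons_iff.2 (.inl this))

theorem IsAdmissible.rtake_append {l x : PathValue} (h : IsAdmissible (⊥ :: l) x) {a : WithBot ℕ}
    (ha : a ≠ ⊥) {N : ℕ} (hN : 0 < N) : IsAdmissible (⊥ :: l) ((x ++ [a]).rtake N) := by
  have hx : x ≠ [] := by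
    rintro rfl
    exact absurd h.1 (not_le.2 (List.nil_lt_cons _ _))
  have htail : ⊥ ∉ (x ++ [a]).tail := by
    rw [List.tail_append_of_ne_nil hx, List.mem_append, List.mem_singleton]
    exact fun h' => h'.elim h.2 (ha ∘ Eq.symm)
  by_cases hlen : (x ++ [a]).length ≤ N
  · rw [List.rtake_eq_self hlen]
    exact ⟨h.1.trans (List.prefix_append _ _).le_of_linearOrder, htail⟩
  · refine isAdmissible_of_bot_notMem ?_ fun hm => htail ?_
    · rw [← List.length_pos_iff, List.length_rtake]
      omega
    · rw [List.rtake, show (x ++ [a]).length - N = ((x ++ [a]).length - N - 1) + 1 by omega,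
        ← List.drop_tail] at hm
      exact List.mem_of_mem_drop hm

/-- A stage of the elimination of wrong values: the sequence is admissible or its last `m` symbols
are different from `⊥`. -/
def IsAdmissibleOrLong (L : PathValue) (m : ℕ) (x : PathValue) : Prop :=
  IsAdmissible L x ∨ ∃ s, s <:+ x ∧ s.length = m ∧ ⊥ ∉ s

theorem IsAdmissibleOrLong.rtake_append {l x : PathValue} {m N : ℕ}
    (h : IsAdmissibleOrLong (⊥ :: l) m x) {a : WithBot ℕ} (ha : a ≠ ⊥) (hm : m < N) :
    IsAdmissibleOrLong (⊥ :: l) (m + 1) ((x ++ [a]).rtake N) := by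
  rcases h with h | ⟨s, ⟨t, rfl⟩, rfl, hs⟩
  · exact .inl (h.rtake_append ha (by omega))
  · refine .inr ⟨s ++ [a], ?_, by simp, ?_⟩
    · refine List.suffix_of_suffix_length_le (l₃ := t ++ s ++ [a]) ⟨t, by simp⟩
        (List.rtake_suffix _ _) ?_
      rw [List.length_rtake]
      simp
      omega
    · rw [List.mem_append, List.mem_singleton]
      exact fun h' => h'.elim hs (ha ∘ Eq.symm)

theorem IsAdmissibleOrLong.isAdmissible_rtake_append {l x : PathValue} {N : ℕ}
    (h : IsAdmissibleOrLong (⊥ :: l) N x) {a : WithBot ℕ} (ha : a ≠ ⊥) (hN : 0 < N) :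
    IsAdmissible (⊥ :: l) ((x ++ [a]).rtake N) := by
  rcases h with h | ⟨s, ⟨t, rfl⟩, rfl, hs⟩
  · exact h.rtake_append ha hN
  · refine isAdmissible_of_bot_notMem ?_ fun hm => ?_
    · rw [← List.length_pos_iff, List.length_rtake]
      simp
      omega
    · have h1 : (t ++ s ++ [a]).rtake s.length <:+ s ++ [a] :=
        List.suffix_of_suffix_length_le (l₃ := t ++ s ++ [a]) (List.rtake_suffix _ _) ⟨t, by simp⟩
          (by rw [List.length_rtake]; simp)
      have h2 := h1.subset hm
      rw [List.mem_append, List.mem_singleton] at h2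
      exact h2.elim hs (ha ∘ Eq.symm)

/-! ### Convergence of the `path` fields -/

/-- The candidate for `path` at `v` that comes from the neighbour at port `j`. -/
def candidate (net : Network V) (v : V) (s : NodeState (net.deg v)) (j : Fin (net.deg v)) :
    PathValue :=
  (s.readPath j ++ [net.farIndex v j]).rtake net.bound

theorem newPath_spec {v : V} (hd : 0 < net.deg v) (s : NodeState (net.deg v)) :
    (∃ j, net.newPath v s = net.candidate v s j) ∧
      ∀ j, net.newPath v s ≤ net.candidate v s j := by
  obtain ⟨x, hx⟩ : ∃ x, ((List.finRange (net.deg v)).map (net.candidate v s)).min? = some x := by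
    rw [← Option.isSome_iff_exists]
    refine List.isSome_min?_of_ne_nil fun h => ?_
    have := congrArg List.length h
    simp at this
    omega
  have e : net.newPath v s = x := by
    unfold newPath
    rw [show (fun j => (s.readPath j ++ [net.farIndex v j]).rtake net.bound) =
      net.candidate v s from rfl, hx]
    rfl
  obtain ⟨h1, h2⟩ := List.min?_eq_some_iff.1 hx
  rw [e]
  refine ⟨?_, fun j => h2 _ (List.mem_map.2 ⟨j, List.mem_finRange j, rfl⟩)⟩
  obtain ⟨j, -, hj⟩ := List.mem_map.1 h1
  exact ⟨j, hj.symm⟩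

section Tree

variable {P : V → PathValue} (hP : ∀ v, net.IsSmallestPath v (P v))
include hP

theorem deg_pos {v : V} (hv : v ≠ net.root) : 0 < net.deg v := by
  obtain ⟨u, h, -⟩ := exists_parent hP hv
  exact (net.graph.degree_pos_iff_exists_adj v).2 ⟨u, h.symm⟩

theorem length_smallestPath_lt_card {u v : V} (hlt : P u < P v) :
    (P u).length < Fintype.card V := by
  obtain ⟨p, hp, hu⟩ := (hP u).1
  have hv : v ∉ p.support := fun hv =>
    absurd (smallestPath_prefix_of_mem_support hP p hp hu hv).le_of_linearOrder (not_le.2 hlt)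
  have h1 := (List.nodup_cons.2 ⟨hv, hp.support_nodup⟩).length_le_card
  rw [hu, List.length_cons, length_indices]
  rw [List.length_cons, SimpleGraph.Walk.length_support] at h1
  omega

theorem rtake_smallestPath_append (hN : Fintype.card V ≤ net.bound) {u v : V} (hlt : P u < P v)
    (a : WithBot ℕ) : (P u ++ [a]).rtake net.bound = P u ++ [a] := by
  refine List.rtake_eq_self ?_
  have := length_smallestPath_lt_card hP hlt
  simp
  omega

/-- A node with a smaller smallest path supplies an admissible candidate. -/
theorem isAdmissible_smallestPath_append {u v w : V} (h : net.graph.Adj u w) (huv : P u < P v)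
    (hvw : P v ≤ P w) : IsAdmissible (P v) (P u ++ [net.edgeIndex h]) := by
  refine ⟨hvw.trans (smallestPath_le_append hP h (huv.trans_le hvw)), ?_⟩
  obtain ⟨l, hl, hbot⟩ := smallestPath_eq_cons hP u
  rw [hl, List.cons_append, List.tail_cons, List.mem_append, List.mem_singleton]
  exact fun h' => h'.elim hbot (edgeIndex_ne_bot h ∘ Eq.symm)

end Tree

section Execution

variable [DecidableEq V] {sched : ℕ → V} {c : ℕ → net.Config}

/-- If all `path` fields eventually satisfy `Q`, then so do eventually the local copies at `v`, and
the `path` field of `v` is eventually computed from such copies. -/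
theorem IsFairExecution.eventually_readPath (hex : net.IsFairExecution sched c) {v : V}
    (hv : v ≠ net.root) (hd : 0 < net.deg v) (Q : V → PathValue → Prop)
    (hQ : ∀ᶠ t in atTop, ∀ w, Q w ((c t).reg w).path) :
    ∀ᶠ t in atTop, (∀ j, Q (net.nbr v j) (((c t).node ⟨v, hv⟩).readPath j)) ∧
      ∃ s : NodeState (net.deg v), (∀ j, Q (net.nbr v j) (s.readPath j)) ∧
        ((c t).reg v).path = net.newPath v s := by
  refine hex.eventually_of_cycle hv hd (E := fun reg _ => ∀ w, Q w (reg w).path) hQ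
    (fun s _ => ∀ j, s.pc = .pathLoop j → ∀ i : Fin (net.deg v), (i : ℕ) < j →
      Q (net.nbr v i) (s.readPath i))
    (fun s r => (∀ j, Q (net.nbr v j) (s.readPath j)) ∧
      ∃ s' : NodeState (net.deg v), (∀ j, Q (net.nbr v j) (s'.readPath j)) ∧
        r.path = net.newPath v s') ?_ ?_ ?_ ?_
  · intro s r h j hj
    rw [h] at hj
    cases hj
  · intro reg s s' r' hE hstep hJ
    cases hstep with
    | readPath j h =>
      intro j' hj' i hi
      obtain rfl : j.succ = j' := by simpa using hj'
      rcases eq_or_ne i j with rfl | hij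
      · simpa using hE (net.nbr v i)
      · have hlt : (i : ℕ) < j := by
          have := Fin.val_ne_of_ne hij
          rw [Fin.val_succ] at hi
          omega
        simp only [Function.update_of_ne hij]
        rcases h with h | ⟨h, -⟩
        · exact hJ _ h i (by simpa using hlt)
        · omega
    | writeOwnBcc =>
      intro j hj i hi
      obtain rfl : 0 = j := by simpa using hj
      simp at hi
    | _ =>
      intro j hj
      cases hj
  · intro reg s s' r' hE hstep hpc hJ
    have hall : ∀ j, Q (net.nbr v j) (s.readPath j) := fun j => hJ _ hpc j (by simp)
    cases hstep with
    | writePath h => exact ⟨hall, s, hall, rfl⟩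
    | readPath j h =>
      rw [hpc] at h
      rcases h with h | ⟨-, ⟨i, h⟩ | ⟨h, -⟩⟩
      · simp [Fin.ext_iff] at h
        omega
      · cases h
      · cases h
    | readCount _ _ _ _ h | writeCount _ _ _ h | readBcc _ h =>
      rw [hpc] at h
      rcases h with ⟨h, -⟩ | ⟨i, h, -⟩ <;> cases h
    | loadPath h | loadCount h | reloadPath h | writeOwnBcc h | writeBcc _ h =>
      rw [hpc] at h
      cases h
  · rintro reg s s' r' hE hstep ⟨h1, h2⟩
    cases hstep with
    | readPath j h =>
      refine ⟨fun i => ?_, h2⟩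
      rcases eq_or_ne i j with rfl | hij
      · simpa using hE (net.nbr v i)
      · simpa only [Function.update_of_ne hij] using h1 i
    | writePath h => exact ⟨h1, s, h1, rfl⟩
    | _ => exact ⟨h1, h2⟩

variable {P : V → PathValue} (hP : ∀ v, net.IsSmallestPath v (P v))
include hP

/-- When the nodes with smaller smallest paths have settled, values below `P v` at the other nodes
are pushed out by truncation, one symbol per cycle. -/
theorem IsFairExecution.eventually_isAdmissibleOrLong (hex : net.IsFairExecution sched c)
    (hN : Fintype.card V ≤ net.bound) {v : V} (hv : v ≠ net.root)
    (hlow : ∀ᶠ t in atTop, ∀ w, P w < P v → ((c t).reg w).path = P w) (m : ℕ)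
    (hm : m ≤ net.bound) :
    ∀ᶠ t in atTop, ∀ w, ¬ P w < P v → IsAdmissibleOrLong (P v) m ((c t).reg w).path := by
  induction m with
  | zero => exact .of_forall fun t w _ => .inr ⟨[], List.nil_suffix, rfl, by simp⟩
  | succ m ih =>
    have ih := ih (by omega)
    refine eventually_all.2 fun w => ?_
    by_cases hw : P w < P v
    · exact .of_forall fun t h => absurd hw h
    have hroot : w ≠ net.root := by
      rintro rfl
      exact hw ((root_prefix hP v).le_of_linearOrder.lt_of_ne fun e =>
        hv (smallestPath_injective hP e).symm)
    have hd := deg_pos hP hroot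
    have key := hex.eventually_readPath hroot hd
      (fun u x => (P u < P v → x = P u) ∧ (¬ P u < P v → IsAdmissibleOrLong (P v) m x))
      ((hlow.and ih).mono fun t h u => ⟨h.1 u, h.2 u⟩)
    refine key.mono fun t h _ => ?_
    obtain ⟨-, s, hs, e⟩ := h
    obtain ⟨j, hj⟩ := (newPath_spec hd s).1
    rw [e, hj, candidate]
    by_cases hn : P (net.nbr w j) < P v
    · rw [(hs j).1 hn, rtake_smallestPath_append hP hN hn]
      exact .inl (isAdmissible_smallestPath_append hP (net.adj_nbr w j).symm hn (not_lt.1 hw))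
    · have h1 := (hs j).2 hn
      obtain ⟨l, hl, -⟩ := smallestPath_eq_cons hP v
      rw [hl] at h1 ⊢
      exact h1.rtake_append (edgeIndex_ne_bot _) hm

/-- The `path` fields converge in the order of the smallest paths. -/
theorem IsFairExecution.eventually_path (hex : net.IsFairExecution sched c)
    (hN : Fintype.card V ≤ net.bound) (v : V) :
    ∀ᶠ t in atTop, ((c t).reg v).path = P v := by
  let _ : LinearOrder V := LinearOrder.lift' P (smallestPath_injective hP)
  induction v using WellFoundedLT.induction with
  | _ v ih =>
  rcases eq_or_ne v net.root with rfl | hv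
  · rw [smallestPath_root hP]
    exact hex.eventually_root.mono fun t h => h.1
  have hlow : ∀ᶠ t in atTop, ∀ w, P w < P v → ((c t).reg w).path = P w :=
    eventually_all.2 fun w => eventually_imp_distrib_left.2 fun hw => ih w hw
  have hhigh := hex.eventually_isAdmissibleOrLong hP hN hv hlow net.bound le_rfl
  have hd := deg_pos hP hv
  have key := hex.eventually_readPath hv hd
    (fun u x => (P u < P v → x = P u) ∧ (¬ P u < P v → IsAdmissibleOrLong (P v) net.bound x))
    ((hlow.and hhigh).mono fun t h u => ⟨h.1 u, h.2 u⟩)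
  refine key.mono fun t h => ?_
  obtain ⟨-, s, hs, e⟩ := h
  obtain ⟨⟨j, hj⟩, hmin⟩ := newPath_spec hd s
  rw [e]
  refine le_antisymm ?_ ?_
  · -- the candidate of the parent is the smallest path itself
    obtain ⟨u, h, hu⟩ := exists_parent hP hv
    have hlt : P u < P v := by
      rw [hu]
      exact (List.prefix_append _ _).le_of_linearOrder.lt_of_ne (by simp)
    obtain ⟨i, rfl, -, hfar⟩ := exists_port h.symm
    have h1 := hmin i
    rwa [candidate, (hs i).1 hlt, rtake_smallestPath_append hP hN hlt, hfar, ← hu] at h1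
  · rw [hj, candidate]
    by_cases hn : P (net.nbr v j) < P v
    · rw [(hs j).1 hn, rtake_smallestPath_append hP hN hn]
      exact (isAdmissible_smallestPath_append hP (net.adj_nbr v j).symm hn le_rfl).1
    · have h1 := (hs j).2 hn
      obtain ⟨l, hl, -⟩ := smallestPath_eq_cons hP v
      have hpos : 0 < net.bound := (Fintype.card_pos_iff.2 ⟨v⟩).trans_le hN
      rw [hl] at h1 ⊢
      exact (h1.isAdmissible_rtake_append (edgeIndex_ne_bot _) hpos).1

end Execution


/-! ### Convergence of the `count` fields -/

/-- The local variables and the register of `v` have the right values of `path`. -/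
def IsSettled (net : Network V) (P : V → PathValue) (v : V) (s : NodeState (net.deg v))
    (r : Register) : Prop :=
  (∀ j, s.readPath j = P (net.nbr v j)) ∧ s.path = P v ∧ r.path = P v

theorem scanCount_spec {P : V → PathValue} {v : V} {s : NodeState (net.deg v)}
    (hread : ∀ j, s.readPath j = P (net.nbr v j)) (hpath : s.path = P v) (cnt : V → ℤ)
    (js : List (Fin (net.deg v))) (a : ℤ) :
    (∀ a' j, net.scanCount v s js a = (a', some j) → ∃ pre post, js = pre ++ j :: post ∧
      a' = a + (pre.map (net.linkContribution P cnt v)).sum ∧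
      P (net.nbr v j) = P v ++ [net.ownIndex v j]) ∧
    ∀ a', net.scanCount v s js a = (a', none) →
      a' = a + (js.map (net.linkContribution P cnt v)).sum := by
  induction js generalizing a with
  | nil => simp [scanCount, eq_comm]
  | cons i js ih =>
    have next : ∀ b, P (net.nbr v i) ≠ P v ++ [net.ownIndex v i] →
        b = a + net.linkContribution P cnt v i →
        net.scanCount v s (i :: js) a = net.scanCount v s js b →
        (∀ a' j, net.scanCount v s (i :: js) a = (a', some j) →
          ∃ pre post, i :: js = pre ++ j :: post ∧
          a' = a + (pre.map (net.linkContribution P cnt v)).sum ∧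
          P (net.nbr v j) = P v ++ [net.ownIndex v j]) ∧
        ∀ a', net.scanCount v s (i :: js) a = (a', none) →
          a' = a + ((i :: js).map (net.linkContribution P cnt v)).sum := by
      rintro b - rfl h
      rw [h]
      obtain ⟨h1, h2⟩ := ih (a + net.linkContribution P cnt v i)
      refine ⟨fun a' j e => ?_, fun a' e => ?_⟩
      · obtain ⟨pre, post, rfl, h3, h4⟩ := h1 a' j e
        exact ⟨i :: pre, post, rfl, by rw [h3, List.map_cons, List.sum_cons, add_assoc], h4⟩
      · rw [h2 a' e, List.map_cons, List.sum_cons, add_assoc]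
    by_cases hc : P (net.nbr v i) = P v ++ [net.ownIndex v i]
    · have e : net.scanCount v s (i :: js) a = (a, some i) := by
        rw [scanCount, hread, hpath, if_pos hc]
      rw [e]
      refine ⟨fun a' j h => ?_, fun a' h => by simp at h⟩
      obtain ⟨rfl, rfl⟩ : a = a' ∧ i = j := by simpa using h
      exact ⟨[], js, rfl, by simp, hc⟩
    · by_cases hi : P v <+: P (net.nbr v i) ∧ P (net.nbr v i) ≠ P v ++ [net.ownIndex v i]
      · refine next (a - 1) hc ?_ ?_
        · rw [linkContribution, if_neg hc, if_pos hi]; ring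
        · rw [scanCount, hread, hpath, if_neg hc, if_pos hi]
      · by_cases ho : P (net.nbr v i) <+: P v ∧ P v ≠ P (net.nbr v i) ++ [net.farIndex v i]
        · refine next (a + 1) hc ?_ ?_
          · rw [linkContribution, if_neg hc, if_neg hi, if_pos ho]
          · rw [scanCount, hread, hpath, if_neg hc, if_neg hi, if_pos ho]
        · refine next a hc ?_ ?_
          · rw [linkContribution, if_neg hc, if_neg hi, if_neg ho]; ring
          · rw [scanCount, hread, hpath, if_neg hc, if_neg hi, if_neg ho]

section Execution

variable [DecidableEq V] {sched : ℕ → V} {c : ℕ → net.Config}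
  {P : V → PathValue} (hP : ∀ v, net.IsSmallestPath v (P v))
include hP

theorem IsFairExecution.eventually_isSettled (hex : net.IsFairExecution sched c)
    (hN : Fintype.card V ≤ net.bound) {v : V} (hv : v ≠ net.root) :
    ∀ᶠ t in atTop, net.IsSettled P v ((c t).node ⟨v, hv⟩) ((c t).reg v) := by
  have hd := deg_pos hP hv
  have hpath : ∀ᶠ t in atTop, ∀ w, ((c t).reg w).path = P w :=
    eventually_all.2 fun w => hex.eventually_path hP hN w
  have hread := hex.eventually_readPath hv hd (fun w x => x = P w) hpath
  have hlocal : ∀ᶠ t in atTop, ((c t).node ⟨v, hv⟩).path = P v := by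
    refine hex.eventually_of_cycle hv hd (E := fun reg _ => (reg v).path = P v)
      (hpath.mono fun t h => h v) (fun s _ => s.pc ≠ .loadPath → s.path = P v)
      (fun s _ => s.path = P v) (fun s r h h' => absurd h h') ?_ ?_ ?_
    · intro reg s s' r' hE hstep hJ
      cases hstep with
      | loadPath | reloadPath => exact fun _ => hE
      | writePath => exact fun h => absurd rfl h
      | readPath j h =>
        refine fun _ => hJ fun h' => ?_
        rw [h'] at h
        rcases h with h | ⟨-, ⟨i, h⟩ | ⟨h, -⟩⟩ <;> cases h
      | readCount _ _ _ _ h | writeCount _ _ _ h | readBcc _ h =>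
        refine fun _ => hJ fun h' => ?_
        rw [h'] at h
        rcases h with ⟨h, -⟩ | ⟨i, h, -⟩ <;> cases h
      | loadCount h | writeOwnBcc h | writeBcc _ h => exact fun _ => hJ (by rw [h]; nofun)
    · intro reg s s' r' hE hstep hpc hJ
      have h := hJ (by rw [hpc]; nofun)
      cases hstep <;> first | exact h | exact hE
    · intro reg s s' r' hE hstep hJ
      cases hstep <;> first | exact hJ | exact hE
  filter_upwards [hread, hlocal, hpath] with t h1 h2 h3
  exact ⟨h1.1, h2, h3 v⟩

/-- If the `count` fields of the children have settled, then so does that of `v`, and the local copy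
on which the test `count = 0` is performed is right as well. -/
theorem IsFairExecution.eventually_count_of_children (hex : net.IsFairExecution sched c)
    (hN : Fintype.card V ≤ net.bound) {v : V} (hv : v ≠ net.root)
    (hchild : ∀ᶠ t in atTop, ∀ j, P (net.nbr v j) = P v ++ [net.ownIndex v j] →
      ((c t).reg (net.nbr v j)).count = net.backCount P (net.nbr v j)) :
    ∀ᶠ t in atTop, ((c t).reg v).count = net.backCount P v ∧
      (((c t).node ⟨v, hv⟩).pc = .testCount →
        ((c t).node ⟨v, hv⟩).count = net.backCount P v) := by
  have hd := deg_pos hP hv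
  set L := net.linkContribution P (net.backCount P) v with hL
  have htotal : net.backCount P v = ((portsFrom (net.deg v) 0).map L).sum := by
    rw [backCount_eq_sum_ports hP, Fin.sum_univ_def, portsFrom_zero]
  -- the partial sum in the middle of the loop, together with what the remaining ports contribute
  let Part : NodeState (net.deg v) → Prop := fun s => ∀ j, s.pc = .gotCount j →
    s.count + s.readCount j + ((portsFrom (net.deg v) (j + 1)).map L).sum = net.backCount P v
  let Loaded : NodeState (net.deg v) → Prop := fun s =>
    s.pc = .reloadPath ∨ s.pc = .testCount → s.count = net.backCount P v
  -- the sum at the beginning of each internal computation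
  have hsum : ∀ s : NodeState (net.deg v), Part s → ∀ (k : ℕ) (a : ℤ),
      (s.pc = .initCount ∧ k = 0 ∧ a = 0 ∨
        ∃ i, s.pc = .gotCount i ∧ k = i + 1 ∧ a = s.count + s.readCount i) →
      a + ((portsFrom (net.deg v) k).map L).sum = net.backCount P v := by
    rintro s hs k a (⟨-, rfl, rfl⟩ | ⟨i, h, rfl, rfl⟩)
    · rw [zero_add, htotal]
    · exact hs i h
  let E : (V → Register) → NodeState (net.deg v) → Prop := fun reg s =>
    net.IsSettled P v s (reg v) ∧ ∀ j, P (net.nbr v j) = P v ++ [net.ownIndex v j] →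
      (reg (net.nbr v j)).count = net.backCount P (net.nbr v j)
  have hpart : ∀ reg s s' r', E reg s → net.LocalStep v reg s s' r' → Part s → Part s' := by
    intro reg s s' r' hE hstep hs
    cases hstep with
    | readCount k a a' j h hscan =>
      intro j' hj'
      obtain rfl : j = j' := by simpa using hj'
      obtain ⟨pre, post, h1, rfl, h3⟩ :=
        (scanCount_spec hE.1.1 hE.1.2.1 (net.backCount P) _ _).1 _ _ hscan
      have h4 := hsum s hs k a h
      rw [h1, eq_portsFrom_of_portsFrom_eq_append h1] at h4
      have h5 : L j = net.backCount P (net.nbr v j) := by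
        rw [hL, linkContribution, if_pos h3]
      simp only [List.map_append, List.sum_append, List.map_cons, List.sum_cons, h5] at h4
      simp only [Function.update_self, hE.2 j h3]
      rw [← h4, hL]
      ring
    | _ =>
      intro j hj
      cases hj
  have hcount : ∀ reg s, E reg s → Part s → ∀ (k : ℕ) (a a' : ℤ),
      (s.pc = .initCount ∧ k = 0 ∧ a = 0 ∨
        ∃ i, s.pc = .gotCount i ∧ k = i + 1 ∧ a = s.count + s.readCount i) →
      net.scanCount v s (portsFrom (net.deg v) k) a = (a', none) → a' = net.backCount P v := by
    intro reg s hE hs k a a' h hscan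
    rw [(scanCount_spec hE.1.1 hE.1.2.1 (net.backCount P) _ _).2 _ hscan]
    exact hsum s hs k a h
  have hloaded : ∀ reg s s' r', net.LocalStep v reg s s' r' → Loaded s →
      (s.pc = .loadCount → (reg v).count = net.backCount P v) → Loaded s' := by
    intro reg s s' r' hstep hs hr
    cases hstep with
    | loadCount h => exact fun _ => hr h
    | reloadPath h => exact fun _ => hs (.inl h)
    | _ =>
      rintro (h | h)
      all_goals cases h
  have key := hex.eventually_of_cycle hv hd (E := E)
    ((hex.eventually_isSettled hP hN hv).and hchild)
    (fun s r => Part s ∧ Loaded s ∧ (s.pc ≠ .loadPath → s.pc ≠ .initCount →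
      (∀ j, s.pc ≠ .gotCount j) → r.count = net.backCount P v))
    (fun s r => Part s ∧ Loaded s ∧ r.count = net.backCount P v) ?_ ?_ ?_ ?_
  · exact key.mono fun t h => ⟨h.2.2, fun hpc => h.2.1 (.inr hpc)⟩
  · intro s r h
    refine ⟨fun j hj => ?_, fun hj => ?_, fun h' => absurd h h'⟩
    · rw [h] at hj; cases hj
    · rw [h] at hj; rcases hj with hj | hj <;> cases hj
  · rintro reg s s' r' hE hstep ⟨h1, h2, h3⟩
    refine ⟨hpart _ _ _ _ hE hstep h1, hloaded _ _ _ _ hstep h2 fun h =>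
      h3 (by rw [h]; nofun) (by rw [h]; nofun) (by rw [h]; nofun), ?_⟩
    cases hstep with
    | readPath j h =>
      refine fun _ _ _ => ?_
      rcases h with h | ⟨-, ⟨i, h⟩ | ⟨h, -⟩⟩ <;>
        exact h3 (by rw [h]; nofun) (by rw [h]; nofun) (by rw [h]; nofun)
    | writePath h => exact fun h => absurd rfl h
    | loadPath h => exact fun _ h => absurd rfl h
    | readCount k a a' j h hscan => exact fun _ _ h => absurd rfl (h j)
    | writeCount k a a' h hscan => exact fun _ _ _ => hcount _ _ hE h1 k a a' h hscan
    | readBcc j h =>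
      refine fun _ _ _ => ?_
      rcases h with ⟨h, -⟩ | ⟨i, h, -⟩ <;>
        exact h3 (by rw [h]; nofun) (by rw [h]; nofun) (by rw [h]; nofun)
    | loadCount h | reloadPath h | writeOwnBcc h | writeBcc _ h =>
      exact fun _ _ _ => h3 (by rw [h]; nofun) (by rw [h]; nofun) (by rw [h]; nofun)
  · rintro reg s s' r' hE hstep hpc ⟨h1, h2, h3⟩
    have h4 := h3 (by rw [hpc]; nofun) (by rw [hpc]; nofun) (by rw [hpc]; nofun)
    refine ⟨hpart _ _ _ _ hE hstep h1, hloaded _ _ _ _ hstep h2 fun _ => h4, ?_⟩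
    cases hstep with
    | writeCount k a a' h hscan => exact hcount _ _ hE h1 k a a' h hscan
    | _ => exact h4
  · rintro reg s s' r' hE hstep ⟨h1, h2, h4⟩
    refine ⟨hpart _ _ _ _ hE hstep h1, hloaded _ _ _ _ hstep h2 fun _ => h4, ?_⟩
    cases hstep with
    | writeCount k a a' h hscan => exact hcount _ _ hE h1 k a a' h hscan
    | _ => exact h4

/-- The `count` fields converge from the leaves of the depth-first search tree upwards. -/
theorem IsFairExecution.eventually_count (hex : net.IsFairExecution sched c)
    (hN : Fintype.card V ≤ net.bound) {v : V} (hv : v ≠ net.root) :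
    ∀ᶠ t in atTop, ((c t).reg v).count = net.backCount P v ∧
      (((c t).node ⟨v, hv⟩).pc = .testCount →
        ((c t).node ⟨v, hv⟩).count = net.backCount P v) := by
  obtain ⟨n, hn⟩ : ∃ n, Fintype.card V - (P v).length = n := ⟨_, rfl⟩
  induction n using Nat.strong_induction_on generalizing v with
  | _ n ih =>
  refine hex.eventually_count_of_children hP hN hv ?_
  refine eventually_all.2 fun j => eventually_imp_distrib_left.2 fun hj => ?_
  have h1 := length_smallestPath_le hP (net.nbr v j)
  have h2 : (P (net.nbr v j)).length = (P v).length + 1 := by rw [hj]; simp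
  exact (ih _ (by omega) (ne_root_of_eq_append hP hj) rfl).mono fun t h => h.1

/-! ### Convergence of the `bcc` fields -/

/-- If `count` is right at `v` and `B` is the smallest path of `v` or the settled `bcc` field of the
parent, according to whether `count` is zero or not, then the `bcc` field of `v` settles at `B`. -/
theorem IsFairExecution.eventually_bcc_eq (hex : net.IsFairExecution sched c)
    (hN : Fintype.card V ≤ net.bound) {v : V} (hv : v ≠ net.root) (B : PathValue)
    (hzero : net.backCount P v = 0 → B = P v)
    (hparent : ∀ᶠ t in atTop, ∀ j, P v = P (net.nbr v j) ++ [net.farIndex v j] →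
      net.backCount P v ≠ 0 → ((c t).reg (net.nbr v j)).bcc = B) :
    ∀ᶠ t in atTop, ((c t).reg v).bcc = B := by
  have hd := deg_pos hP hv
  obtain ⟨u, hu, eu⟩ := exists_parent hP hv
  obtain ⟨j₀, rfl, -, hfar⟩ := exists_port hu.symm
  let Reading : NodeState (net.deg v) → Prop := fun s =>
    (∀ j, s.pc = .gotBcc j → net.backCount P v ≠ 0 ∧ s.readBcc j = B) ∧
      ∀ j, s.pc = .wroteBcc j → net.backCount P v ≠ 0
  let E : (V → Register) → NodeState (net.deg v) → Prop := fun reg s =>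
    net.IsSettled P v s (reg v) ∧ (s.pc = .testCount → s.count = net.backCount P v) ∧
      ∀ j, P v = P (net.nbr v j) ++ [net.farIndex v j] → net.backCount P v ≠ 0 →
        (reg (net.nbr v j)).bcc = B
  have hreading : ∀ reg s s' r', E reg s → net.LocalStep v reg s s' r' → Reading s →
      Reading s' := by
    intro reg s s' r' hE hstep hs
    cases hstep with
    | readBcc j h hj =>
      have h0 : net.backCount P v ≠ 0 := by
        rcases h with ⟨h1, h2⟩ | ⟨i, h1, -⟩
        · rwa [← hE.2.1 h1]
        · exact hs.2 i h1
      refine ⟨fun j' hj' => ⟨h0, ?_⟩, fun j' hj' => by cases hj'⟩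
      obtain rfl : j = j' := by simpa using hj'
      rw [hE.1.2.1, hE.1.1] at hj
      simpa using hE.2.2 j hj h0
    | writeBcc j h =>
      exact ⟨fun j' hj' => by (cases hj'), fun _ _ => (hs.1 j h).1⟩
    | _ => exact ⟨fun j' hj' => by (cases hj'), fun j' hj' => by (cases hj')⟩
  have hown : ∀ reg s, E reg s → s.pc = .testCount → s.count = 0 → s.path = B := by
    intro reg s hE h h0
    rw [hE.1.2.1, hzero (by rw [← hE.2.1 h, h0])]
  have key := hex.eventually_of_cycle hv hd (E := E)
    ((hex.eventually_isSettled hP hN hv).and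
      (((hex.eventually_count hP hN hv).mono fun t h => h.2).and hparent))
    (fun s r => Reading s ∧ ((∃ j, s.pc = .wroteBcc j) ∨ (∃ j, s.pc = .pathLoop j) → r.bcc = B))
    (fun s r => Reading s ∧ r.bcc = B) ?_ ?_ ?_ ?_
  · exact key.mono fun t h => h.2
  · intro s r h
    refine ⟨⟨fun j hj => ?_, fun j hj => ?_⟩, fun hj => ?_⟩
    · rw [h] at hj; cases hj
    · rw [h] at hj; cases hj
    · rw [h] at hj; rcases hj with ⟨j, hj⟩ | ⟨j, hj⟩ <;> cases hj
  · rintro reg s s' r' hE hstep ⟨h1, h2⟩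
    refine ⟨hreading _ _ _ _ hE hstep h1, ?_⟩
    cases hstep with
    | readPath j h =>
      refine fun _ => ?_
      rcases h with h | ⟨-, ⟨i, h⟩ | ⟨-, -, h⟩⟩
      · exact h2 (.inr ⟨_, h⟩)
      · exact h2 (.inl ⟨_, h⟩)
      · -- the parent link is found, so that the loop cannot be left without a write
        exact absurd (by rw [hE.1.2.1, hE.1.1, hfar, ← eu]) (h j₀)
    | writeOwnBcc h h0 => exact fun _ => hown _ _ hE h h0
    | writeBcc j h => exact fun _ => (h1.1 j h).2
    | _ =>
      rintro (⟨j, hj⟩ | ⟨j, hj⟩)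
      all_goals cases hj
  · rintro reg s s' r' hE hstep hpc ⟨h1, h2⟩
    have h3 := h2 (.inr ⟨_, hpc⟩)
    refine ⟨hreading _ _ _ _ hE hstep h1, ?_⟩
    cases hstep with
    | writeOwnBcc h h0 => exact hown _ _ hE h h0
    | writeBcc j h => exact (h1.1 j h).2
    | _ => exact h3
  · rintro reg s s' r' hE hstep ⟨h1, h3⟩
    refine ⟨hreading _ _ _ _ hE hstep h1, ?_⟩
    cases hstep with
    | writeOwnBcc h h0 => exact hown _ _ hE h h0
    | writeBcc j h => exact (h1.1 j h).2
    | _ => exact h3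

/-- The `bcc` fields converge from the root of the depth-first search tree downwards. -/
theorem IsFairExecution.eventually_bcc (hex : net.IsFairExecution sched c)
    (hN : Fintype.card V ≤ net.bound) {v r : V} (hr : net.IsRepresentative r v) :
    ∀ᶠ t in atTop, ((c t).reg v).bcc = P r := by
  obtain ⟨n, hn⟩ : ∃ n, (P v).length = n := ⟨_, rfl⟩
  induction n using Nat.strong_induction_on generalizing v with
  | _ n ih =>
  rcases eq_or_ne v net.root with rfl | hv
  · rw [isRepresentative_unique hP hr (isRepresentative_root hP), smallestPath_root hP]
    exact hex.eventually_root.mono fun t h => h.2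
  refine hex.eventually_bcc_eq hP hN hv (P r) (fun h0 => ?_) ?_
  · rw [isRepresentative_unique hP hr (isRepresentative_self hP hv h0)]
  · refine eventually_all.2 fun j => eventually_imp_distrib_left.2 fun hj =>
      eventually_imp_distrib_left.2 fun h0 => ih _ ?_ ?_ rfl
    · rw [← hn, hj]; simp
    · obtain ⟨r', hr'⟩ := exists_isRepresentative hP (net.nbr v j)
      have h1 := isRepresentative_of_parent hP (net.adj_nbr v j).symm hj h0 hr'
      rwa [isRepresentative_unique hP hr h1]

end Execution

end Network

theorem mainTheorem1 {V : Type*} [Fintype V] [DecidableEq V] (net : Network V)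
    (hconn : net.graph.Connected) (hN : Fintype.card V ≤ net.bound) :
    (∀ v : V, ∃! u : V, net.IsRepresentative u v) ∧
    ∀ (sched : ℕ → V) (c : ℕ → net.Config), net.IsFairExecution sched c →
      ∃ k : ℕ, ∀ t : ℕ, k ≤ t →
        (∀ v : V, net.IsSmallestPath v ((c t).reg v).path) ∧
        ∀ v u : V, net.IsRepresentative u v → ((c t).reg v).bcc = ((c t).reg u).path := by
  choose P hP using fun v => Network.exists_isSmallestPath hconn v
  refine ⟨fun v => ?_, fun sched c hex => ?_⟩
  · obtain ⟨r, hr⟩ := Network.exists_isRepresentative hP v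
    exact ⟨r, hr, fun u hu => Network.isRepresentative_unique hP hu hr⟩
  · have hpath : ∀ᶠ t in Filter.atTop, ∀ v, ((c t).reg v).path = P v :=
      Filter.eventually_all.2 fun v => hex.eventually_path hP hN v
    have hbcc : ∀ᶠ t in Filter.atTop, ∀ v u, net.IsRepresentative u v →
        ((c t).reg v).bcc = P u :=
      Filter.eventually_all.2 fun v => Filter.eventually_all.2 fun u =>
        Filter.eventually_imp_distrib_left.2 fun hu => hex.eventually_bcc hP hN hu
    obtain ⟨k, hk⟩ := Filter.eventually_atTop.1 (hpath.and hbcc)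
    refine ⟨k, fun t ht => ⟨fun v => ?_, fun v u hu => ?_⟩⟩
    · rw [(hk t ht).1 v]
      exact hP v
    · rw [(hk t ht).1 u, (hk t ht).2 v u hu]
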